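/- **Setting.** Let $(M,g)$ be a smooth 4-dimensional Lorentzian manifold of signature $(+,-,-,-)$ with a spin structure: a smooth complex vector bundle $S\to M$ of rank two, a smooth nowhere vanishing antisymmetric spinor $\epsilon_{AB}$, and a smooth hermitian soldering form $\sigma_a{}^{AA'}$ with $\sigma^a{}_{AA'}\sigma_{aBB'}=\epsilon_{BA}\bar\epsilon_{B'A'}$ and $\sigma^a{}_{AA'}\sigma_b{}^{AA'}=\delta^a{}_b$. Spinor indices are moved by $\xi_B=\xi^A\epsilon_{AB}$, $\xi^A=\epsilon^{AB}\xi_B$, where $\epsilon_{AB}\epsilon^{CB}=\delta_A{}^C$, and similarly for primed indices. Tensors and spinors are translated into each other (tensor and spinor *counterparts*) by contracting each pair of indices $AA'$ with $\sigma$. Let $\nabla_a$ be the torsion-free covariant derivative on tensors and spinors with $\nabla_a\sigma_b{}^{AA'}=0$ and $\nabla_a\epsilon_{AB}=0$ (on tensors it is the Levi-Civita connection), and put $\nabla_{AA'}=\sigma^a{}_{AA'}\nabla_a$. Let $\eta_{abcd}$ be the volume form of $g$, oriented so that its spinor counterpart is $$\eta_{AA'BB'CC'DD'}=i\left(\epsilon_{AC}\epsilon_{BD}\bar\epsilon_{A'D'}\bar\epsilon_{B'C'}-\epsilon_{AD}\epsilon_{BC}\bar\epsilon_{A'C'}\bar\epsilon_{B'D'}\right),$$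 and let $M$ be time oriented so that the null vectors representing $\kappa^A\bar\kappa^{A'}$ with $\kappa\neq0$ are future-directed. Let $G_{ab}=R_{ab}-\tfrac12Rg_{ab}$ be the Einstein tensor, where $R_{ab}=R^c{}_{acb}$ and $(\nabla_a\nabla_b-\nabla_b\nabla_a)V^c=R^c{}_{dab}V^d$. **Theorem (Sparling identity).** Let $\lambda^A$ be any smooth spinor field (section of $S$). Let $\xi^a$ be the vector field representing $\lambda^A\bar\lambda^{A'}$, let $\mathcal F_{ab}$ be the tensor counterpart of the Nester–Witten spinor $$\Xi_{AA'BB'}=\frac i2\left(\bar\lambda_{A'}\nabla_{BB'}\lambda_A-\bar\lambda_{B'}\nabla_{AA'}\lambda_B\right),$$ and let $\mathcal Z_{abc}$ be the tensor counterpart of $\nabla_{BC'}\lambda_A\,\nabla_{CB'}\bar\lambda_{A'}$. Then $\mathcal F_{ab}$ is a smooth (complex-valued) 2-form, and $$3\nabla_{[a}\mathcal F_{bc]}=\eta_{abcf}\left(\mathcal Z_d{}^{[df]}-\frac14G_d{}^f\xi^d\right)$$ on $M$. Moreover, for any three future-directed null vectors $k_1^a,k_2^a,k_3^a$ at a point of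 $M$, the number $\mathcal Z_{abc}k_1^ak_2^bk_3^c$ is real and $$\mathcal Z_{abc}k_1^ak_2^bk_3^c\ge0 .$$ -/

import Mathlib

open Bundle Manifold
open scoped ContDiff ComplexConjugate

noncomputable section

namespace Sparling

/-- The model space of a 4-dimensional manifold. -/
abbrev E4 : Type := EuclideanSpace ℝ (Fin 4)

/-- The diagonal `(+,-,-,-)` of the Minkowski metric. -/
def sgn : Fin 4 → ℝ := ![1, -1, -1, -1]

/-- The components `ε^{AB}` of the inverse symplectic metric in a basis with `ε_{01} = 1`; they are
fixed by `ε_{AB} ε^{CB} = δ_A^C`. The components of `ε_{AB}` are given by the same matrix. -/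
def epsUp : Fin 2 → Fin 2 → ℂ := ![![0, 1], ![-1, 0]]

/-- Smoothness at `x` of a (not necessarily globally smooth) vector field. -/
def SmoothFieldAt {M : Type*} [TopologicalSpace M] [ChartedSpace E4 M]
    [IsManifold (𝓡 4) ∞ M] (X : ∀ y : M, TangentSpace (𝓡 4) y) (x : M) : Prop :=
  ContMDiffAt (𝓡 4) ((𝓡 4).prod 𝓘(ℝ, E4)) ∞
    (fun y => (TotalSpace.mk' E4 y (X y) : TangentBundle (𝓡 4) M)) x

/-- A smooth metric of signature `(+,-,-,-)` on a 4-manifold. -/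
structure LorentzMetric (M : Type*) [TopologicalSpace M] [ChartedSpace E4 M]
    [IsManifold (𝓡 4) ∞ M] where
  /-- the bilinear form `g_{ab}` on each tangent space -/
  val : ∀ x : M, TangentSpace (𝓡 4) x →L[ℝ] TangentSpace (𝓡 4) x →L[ℝ] ℝ
  contMDiff : ContMDiff (𝓡 4) ((𝓡 4).prod 𝓘(ℝ, E4 →L[ℝ] E4 →L[ℝ] ℝ)) ∞
    (fun x => TotalSpace.mk' (E4 →L[ℝ] E4 →L[ℝ] ℝ) x (val x))
  symm : ∀ x u v, val x u v = val x v u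
  exists_frame : ∀ x, ∃ e : Module.Basis (Fin 4) ℝ (TangentSpace (𝓡 4) x),
    ∀ i j, val x (e i) (e j) = if i = j then sgn i else 0

section Metric

variable {M : Type*} [TopologicalSpace M] [ChartedSpace E4 M] [IsManifold (𝓡 4) ∞ M]

/-- `e` is an orthonormal frame of the tangent space at `x`. -/
def LorentzMetric.IsOrthonormal (g : LorentzMetric M) (x : M)
    (e : Module.Basis (Fin 4) ℝ (TangentSpace (𝓡 4) x)) : Prop :=
  ∀ i j, g.val x (e i) (e j) = if i = j then sgn i else 0

/-- A chosen orthonormal frame at `x`; it only serves to write out contractions of tensor indices,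
which do not depend on it. No continuity in `x` is asked for. -/
def LorentzMetric.frame (g : LorentzMetric M) (x : M) :
    Module.Basis (Fin 4) ℝ (TangentSpace (𝓡 4) x) :=
  (g.exists_frame x).choose

theorem LorentzMetric.frame_isOrthonormal (g : LorentzMetric M) (x : M) :
    g.IsOrthonormal x (g.frame x) :=
  (g.exists_frame x).choose_spec

/-- The curvature operator
`R(X,Y)W = ∇_X ∇_Y W - ∇_Y ∇_X W - ∇_{[X,Y]} W` of an affine connection, on vector fields. -/
def curvatureField (nT : CovariantDerivative (𝓡 4) E4 (TangentSpace (𝓡 4) : M → Type _))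
    (X Y W : ∀ y : M, TangentSpace (𝓡 4) y) (x : M) : TangentSpace (𝓡 4) x :=
  nT (fun y => nT W y (Y y)) x (X x) - nT (fun y => nT W y (X y)) x (Y x)
    - nT W x (VectorField.mlieBracket (𝓡 4) X Y x)

/-- The Riemann tensor at `x`: the curvature operator on local smooth extensions of the three
tangent vectors (it does not depend on the extensions). -/
def riemann (nT : CovariantDerivative (𝓡 4) E4 (TangentSpace (𝓡 4) : M → Type _))
    (x : M) (u v w : TangentSpace (𝓡 4) x) : TangentSpace (𝓡 4) x :=
  curvatureField nT (FiberBundle.extend E4 u) (FiberBundle.extend E4 v)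
    (FiberBundle.extend E4 w) x

/-- The Ricci tensor `Ric(v,w) = tr (u ↦ R(u,v)w)`. -/
def ricci (g : LorentzMetric M)
    (nT : CovariantDerivative (𝓡 4) E4 (TangentSpace (𝓡 4) : M → Type _))
    (x : M) (v w : TangentSpace (𝓡 4) x) : ℝ :=
  ∑ i, (g.frame x).repr (riemann nT x (g.frame x i) v w) i

/-- The scalar curvature `g^{ab} R_{ab}`. -/
def scalarCurvature (g : LorentzMetric M)
    (nT : CovariantDerivative (𝓡 4) E4 (TangentSpace (𝓡 4) : M → Type _)) (x : M) : ℝ :=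
  ∑ i, sgn i * ricci g nT x (g.frame x i) (g.frame x i)

/-- The Einstein tensor `G_{ab} = R_{ab} - (1/2) R g_{ab}`. -/
def einstein (g : LorentzMetric M)
    (nT : CovariantDerivative (𝓡 4) E4 (TangentSpace (𝓡 4) : M → Type _))
    (x : M) (v w : TangentSpace (𝓡 4) x) : ℝ :=
  ricci g nT x v w - 1 / 2 * scalarCurvature g nT x * g.val x v w

/-- The covariant derivative `(∇_u F)(v,w) = u(F(v,w)) - F(∇_u v, w) - F(v, ∇_u w)` of a complex
valued covariant 2-tensor field, where `v`, `w` are extended to local smooth vector fields (the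
result does not depend on the extensions). -/
def covDerivTwo (nT : CovariantDerivative (𝓡 4) E4 (TangentSpace (𝓡 4) : M → Type _))
    (F : ∀ y : M, TangentSpace (𝓡 4) y → TangentSpace (𝓡 4) y → ℂ)
    (x : M) (u v w : TangentSpace (𝓡 4) x) : ℂ :=
  mvfderiv (𝓡 4) (fun y => F y (FiberBundle.extend E4 v y) (FiberBundle.extend E4 w y)) x u
    - F x (nT (FiberBundle.extend E4 v) x u) w
    - F x v (nT (FiberBundle.extend E4 w) x u)

/-- The total antisymmetrization `T_{[abc]}`. -/
def antisymm₃ {L : Type*} (T : L → L → L → ℂ) (u v w : L) : ℂ :=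
  1 / 6 * (T u v w + T v w u + T w u v - T u w v - T v u w - T w v u)

end Metric

/-- A spin structure on `(M, g)`: on a complex vector bundle `S` over `M`, a smooth symplectic form
`ε_{AB}` and a smooth soldering form `σ_{aAA'}`. The value `σ x v α β` is
`v^a σ_{aAA'} α^A \bar β^{A'}`. That `S` has rank two is part of `exists_spinFrame`. -/
structure SpinStructure {M : Type*} [TopologicalSpace M] [ChartedSpace E4 M]
    [IsManifold (𝓡 4) ∞ M] (g : LorentzMetric M)
    (V : Type*) [NormedAddCommGroup V] [NormedSpace ℂ V]
    (S : M → Type*) [TopologicalSpace (TotalSpace V S)]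
    [∀ x, AddCommGroup (S x)] [∀ x, Module ℂ (S x)] [∀ x, TopologicalSpace (S x)]
    [FiberBundle V S] where
  /-- the symplectic metric `ε_{AB} α^A β^B` -/
  ε : ∀ x, S x →ₗ[ℂ] S x →ₗ[ℂ] ℂ
  /-- the soldering form `σ_{aAA'}` -/
  σ : ∀ x, TangentSpace (𝓡 4) x →ₗ[ℝ] (S x →ₗ[ℂ] S x →ₗ⋆[ℂ] ℂ)
  ε_alt : ∀ x α, ε x α α = 0
  exists_spinFrame : ∀ x, ∃ s : Module.Basis (Fin 2) ℂ (S x), ε x (s 0) (s 1) = 1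
  ε_smooth : ∀ (x : M) (α β : ∀ y, S y),
    ContMDiffAt (𝓡 4) ((𝓡 4).prod 𝓘(ℝ, V)) ∞ (fun y => TotalSpace.mk' V y (α y)) x →
    ContMDiffAt (𝓡 4) ((𝓡 4).prod 𝓘(ℝ, V)) ∞ (fun y => TotalSpace.mk' V y (β y)) x →
    ContMDiffAt (𝓡 4) 𝓘(ℝ, ℂ) ∞ (fun y => ε y (α y) (β y)) x
  σ_smooth : ∀ (x : M) (X : ∀ y : M, TangentSpace (𝓡 4) y) (α β : ∀ y, S y),
    SmoothFieldAt X x →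
    ContMDiffAt (𝓡 4) ((𝓡 4).prod 𝓘(ℝ, V)) ∞ (fun y => TotalSpace.mk' V y (α y)) x →
    ContMDiffAt (𝓡 4) ((𝓡 4).prod 𝓘(ℝ, V)) ∞ (fun y => TotalSpace.mk' V y (β y)) x →
    ContMDiffAt (𝓡 4) 𝓘(ℝ, ℂ) ∞ (fun y => σ y (X y) (α y) (β y)) x
  /-- `σ` is hermitian -/
  σ_hermitian : ∀ x v α β, σ x v α β = conj (σ x v β α)
  /-- `σ^a_{AA'} σ_{aBB'} = ε_{BA} \bar ε_{B'A'}` -/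
  σ_contract_tensor : ∀ (x : M) (e : Module.Basis (Fin 4) ℝ (TangentSpace (𝓡 4) x)),
    g.IsOrthonormal x e → ∀ α α' β β' : S x,
      ∑ i, (sgn i : ℂ) * (σ x (e i) α α' * σ x (e i) β β') = ε x β α * conj (ε x β' α')
  /-- `σ_{aAA'} σ_b^{AA'} = g_{ab}` -/
  σ_contract_spinor : ∀ (x : M) (s : Module.Basis (Fin 2) ℂ (S x)), ε x (s 0) (s 1) = 1 →
    ∀ u v : TangentSpace (𝓡 4) x,
      ∑ A, ∑ A', ∑ B, ∑ B', epsUp A B * conj (epsUp A' B') *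
        (σ x u (s A) (s A') * σ x v (s B) (s B')) = (g.val x u v : ℂ)

section Spin

variable {M : Type*} [TopologicalSpace M] [ChartedSpace E4 M] [IsManifold (𝓡 4) ∞ M]
  {g : LorentzMetric M}
  {V : Type*} [NormedAddCommGroup V] [NormedSpace ℂ V]
  {S : M → Type*} [TopologicalSpace (TotalSpace V S)]
  [∀ x, AddCommGroup (S x)] [∀ x, Module ℂ (S x)] [∀ x, TopologicalSpace (S x)]
  [FiberBundle V S]

namespace SpinStructure

/-- A chosen basis of the spin space at `x` with `ε_{01} = 1`; it only serves to write out
contractions of spinor indices, which do not depend on it. -/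
def spinFrame (P : SpinStructure g V S) (x : M) : Module.Basis (Fin 2) ℂ (S x) :=
  (P.exists_spinFrame x).choose

theorem spinFrame_spec (P : SpinStructure g V S) (x : M) :
    P.ε x (P.spinFrame x 0) (P.spinFrame x 1) = 1 :=
  (P.exists_spinFrame x).choose_spec

/-- The components of the covector `α_A = α^B ε_{BA}`. -/
def low (P : SpinStructure g V S) (x : M) (α : S x) (A : Fin 2) : ℂ :=
  P.ε x α (P.spinFrame x A)

/-- The components `v^a σ_{aAA'}`. -/
def sigLow (P : SpinStructure g V S) (x : M) (v : TangentSpace (𝓡 4) x) (A A' : Fin 2) : ℂ :=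
  P.σ x v (P.spinFrame x A) (P.spinFrame x A')

/-- The components `v^a σ_a^{AA'} = v^a ε^{AB} \bar ε^{A'B'} σ_{aBB'}`. -/
def sigUp (P : SpinStructure g V S) (x : M) (v : TangentSpace (𝓡 4) x) (A A' : Fin 2) : ℂ :=
  ∑ B, ∑ B', epsUp A B * conj (epsUp A' B') * P.sigLow x v B B'

/-- The vector `ξ^a = σ^a_{AA'} κ^A \bar κ^{A'}` representing `κ^A \bar κ^{A'}`. -/
def toVector (P : SpinStructure g V S) (x : M) (κ : S x) : TangentSpace (𝓡 4) x :=
  ∑ i, (sgn i * (P.σ x (g.frame x i) κ κ).re) • g.frame x i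

/-- The volume 4-form `η_{abcd}` of the metric, for the orientation in which its spinor counterpart
is `i (ε_{AC} ε_{BD} \bar ε_{A'D'} \bar ε_{B'C'} - ε_{AD} ε_{BC} \bar ε_{A'C'} \bar ε_{B'D'})`. -/
def volumeForm (P : SpinStructure g V S) (x : M) (u v w z : TangentSpace (𝓡 4) x) : ℂ :=
  ∑ A, ∑ A', ∑ B, ∑ B', ∑ C, ∑ C', ∑ D, ∑ D',
    P.sigUp x u A A' * P.sigUp x v B B' * P.sigUp x w C C' * P.sigUp x z D D' *
      (Complex.I *
        (epsUp A C * epsUp B D * conj (epsUp A' D') * conj (epsUp B' C')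
          - epsUp A D * epsUp B C * conj (epsUp A' C') * conj (epsUp B' D')))

/-- `η` is, up to the factor `-i`, the determinant of the components `σ_{aAA'}` of its arguments;
in particular it is alternating. -/
theorem volumeForm_eq_det (P : SpinStructure g V S) (x : M) (v : Fin 4 → TangentSpace (𝓡 4) x) :
    P.volumeForm x (v 0) (v 1) (v 2) (v 3) =
      -(Complex.I * Matrix.det (Matrix.of fun i => ![P.sigLow x (v i) 0 0, P.sigLow x (v i) 0 1,
        P.sigLow x (v i) 1 0, P.sigLow x (v i) 1 1])) := by
  simp only [volumeForm, sigUp, Fin.sum_univ_two, epsUp]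
  simp [Matrix.det_succ_row_zero, Fin.sum_univ_succ, Fin.succAbove]
  ring

/-- `η` takes the values `±1` on orthonormal frames, so it is a volume form of the metric. -/
theorem volumeForm_frame (P : SpinStructure g V S) (x : M)
    (e : Module.Basis (Fin 4) ℝ (TangentSpace (𝓡 4) x)) (he : g.IsOrthonormal x e) :
    P.volumeForm x (e 0) (e 1) (e 2) (e 3) = 1 ∨ P.volumeForm x (e 0) (e 1) (e 2) (e 3) = -1 := by
  let N : Matrix (Fin 4) (Fin 4) ℂ := Matrix.of fun i =>
    ![P.sigLow x (e i) 0 0, P.sigLow x (e i) 0 1, P.sigLow x (e i) 1 0, P.sigLow x (e i) 1 1]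
  let J : Matrix (Fin 4) (Fin 4) ℂ := !![0, 0, 0, 1; 0, 0, -1, 0; 0, -1, 0, 0; 1, 0, 0, 0]
  have hJ : J.det = 1 := by
    simp [J, Matrix.det_succ_row_zero, Fin.sum_univ_succ, Fin.succAbove]
    norm_num
  have hN : N * J * N.transpose = Matrix.diagonal fun i => (sgn i : ℂ) := by
    ext i j
    have h := P.σ_contract_spinor x (P.spinFrame x) (P.spinFrame_spec x) (e i) (e j)
    rw [he i j] at h
    simp only [Fin.sum_univ_two, epsUp] at h
    simp only [Matrix.mul_apply, Matrix.transpose_apply, Matrix.diagonal_apply,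
      Fin.sum_univ_four, N, J, sigLow]
    simp only [apply_ite Complex.ofReal, Complex.ofReal_zero] at h
    rw [← h]
    simp
    ring
  have hd : N.det ^ 2 = -1 := by
    have h := congrArg Matrix.det hN
    rw [Matrix.det_mul, Matrix.det_mul, Matrix.det_transpose, hJ, Matrix.det_diagonal] at h
    simp [Fin.prod_univ_four, sgn] at h
    rw [← h]; ring
  have hv : P.volumeForm x (e 0) (e 1) (e 2) (e 3) = -(Complex.I * N.det) :=
    P.volumeForm_eq_det x e
  have hs : P.volumeForm x (e 0) (e 1) (e 2) (e 3) ^ 2 = 1 := by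
    rw [hv, neg_sq, mul_pow, hd]; simp
  simpa using hs

/-- Future-directed timelike vectors, for the time orientation in which the vectors
`κ^A \bar κ^{A'}` point to the future. -/
def IsFutureTimelike (P : SpinStructure g V S) (x : M) (t : TangentSpace (𝓡 4) x) : Prop :=
  0 < g.val x t t ∧ ∀ κ : S x, κ ≠ 0 → 0 < (P.σ x t κ κ).re

/-- Future-directed null vectors: the nonzero null vectors that have a positive inner product with
every future-directed timelike vector. -/
def IsFutureNull (P : SpinStructure g V S) (x : M) (k : TangentSpace (𝓡 4) x) : Prop :=
  k ≠ 0 ∧ g.val x k k = 0 ∧ ∀ t, P.IsFutureTimelike x t → 0 < g.val x k t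

end SpinStructure

variable [∀ x, IsTopologicalAddGroup (S x)] [∀ x, ContinuousSMul ℝ (S x)]
  [VectorBundle ℝ V S]

/-- `∇` (given by its actions `nT` on vector fields and `nS` on spinor fields) is the torsion-free
spin covariant derivative with `∇_a ε_{AB} = 0`: both actions are smooth, `nS` is complex linear,
and `∇_a σ_{bAA'} = 0`, where `∇` acts on complex conjugate spinors by conjugation. -/
structure IsSpinCovariantDerivative (P : SpinStructure g V S)
    (nT : CovariantDerivative (𝓡 4) E4 (TangentSpace (𝓡 4) : M → Type _))
    (nS : CovariantDerivative (𝓡 4) V S) : Prop where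
  smooth_tangent : CovariantDerivative.ContMDiffCovariantDerivative nT ∞
  smooth_spin : CovariantDerivative.ContMDiffCovariantDerivative nS ∞
  torsion_free : nT.torsion = 0
  complex_linear : ∀ (x : M) (α : ∀ y, S y) (v : TangentSpace (𝓡 4) x),
    MDifferentiableAt (𝓡 4) ((𝓡 4).prod 𝓘(ℝ, V)) (fun y => TotalSpace.mk' V y (α y)) x →
    nS (fun y => Complex.I • α y) x v = Complex.I • nS α x v
  ε_parallel : ∀ (x : M) (α β : ∀ y, S y) (v : TangentSpace (𝓡 4) x),
    MDifferentiableAt (𝓡 4) ((𝓡 4).prod 𝓘(ℝ, V)) (fun y => TotalSpace.mk' V y (α y)) x →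
    MDifferentiableAt (𝓡 4) ((𝓡 4).prod 𝓘(ℝ, V)) (fun y => TotalSpace.mk' V y (β y)) x →
    mvfderiv (𝓡 4) (fun y => P.ε y (α y) (β y)) x v
      = P.ε x (nS α x v) (β x) + P.ε x (α x) (nS β x v)
  σ_parallel : ∀ (x : M) (X : ∀ y : M, TangentSpace (𝓡 4) y) (α β : ∀ y, S y)
    (v : TangentSpace (𝓡 4) x),
    MDifferentiableAt (𝓡 4) ((𝓡 4).prod 𝓘(ℝ, E4))
      (fun y => (TotalSpace.mk' E4 y (X y) : TangentBundle (𝓡 4) M)) x →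
    MDifferentiableAt (𝓡 4) ((𝓡 4).prod 𝓘(ℝ, V)) (fun y => TotalSpace.mk' V y (α y)) x →
    MDifferentiableAt (𝓡 4) ((𝓡 4).prod 𝓘(ℝ, V)) (fun y => TotalSpace.mk' V y (β y)) x →
    mvfderiv (𝓡 4) (fun y => P.σ y (X y) (α y) (β y)) x v
      = P.σ x (nT X x v) (α x) (β x) + P.σ x (X x) (nS α x v) (β x)
        + P.σ x (X x) (α x) (nS β x v)

namespace SpinStructure

/-- The components `∇_{BB'} λ_A = σ^b_{BB'} ∇_b λ_A`. -/
def nabla (P : SpinStructure g V S) (nS : CovariantDerivative (𝓡 4) V S) (lam : ∀ y, S y)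
    (x : M) (B B' A : Fin 2) : ℂ :=
  ∑ i, (sgn i : ℂ) * P.sigLow x (g.frame x i) B B' * P.low x (nS lam x (g.frame x i)) A

/-- The components `∇_{BB'} \bar λ_{A'} = σ^b_{BB'} ∇_b \bar λ_{A'}`. -/
def nablaConj (P : SpinStructure g V S) (nS : CovariantDerivative (𝓡 4) V S) (lam : ∀ y, S y)
    (x : M) (B B' A' : Fin 2) : ℂ :=
  ∑ i, (sgn i : ℂ) * P.sigLow x (g.frame x i) B B' * conj (P.low x (nS lam x (g.frame x i)) A')

/-- The Nester–Witten spinor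
`Ξ_{AA'BB'} = (i/2) (\bar λ_{A'} ∇_{BB'} λ_A - \bar λ_{B'} ∇_{AA'} λ_B)`. -/
def nesterWitten (P : SpinStructure g V S) (nS : CovariantDerivative (𝓡 4) V S) (lam : ∀ y, S y)
    (x : M) (A A' B B' : Fin 2) : ℂ :=
  Complex.I / 2 * (conj (P.low x (lam x) A') * P.nabla nS lam x B B' A
    - conj (P.low x (lam x) B') * P.nabla nS lam x A A' B)

/-- The Nester–Witten 2-form `F_{ab} = σ_a^{AA'} σ_b^{BB'} Ξ_{AA'BB'}`. -/
def nesterWittenForm (P : SpinStructure g V S) (nS : CovariantDerivative (𝓡 4) V S)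
    (lam : ∀ y, S y) (x : M) (u v : TangentSpace (𝓡 4) x) : ℂ :=
  ∑ A, ∑ A', ∑ B, ∑ B',
    P.sigUp x u A A' * P.sigUp x v B B' * P.nesterWitten nS lam x A A' B B'

/-- The tensor `Z_{abc}` with spinor counterpart `∇_{BC'} λ_A ∇_{CB'} \bar λ_{A'}`. -/
def sparlingZ (P : SpinStructure g V S) (nS : CovariantDerivative (𝓡 4) V S)
    (lam : ∀ y, S y) (x : M) (u v w : TangentSpace (𝓡 4) x) : ℂ :=
  ∑ A, ∑ A', ∑ B, ∑ B', ∑ C, ∑ C',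
    P.sigUp x u A A' * P.sigUp x v B B' * P.sigUp x w C C' *
      (P.nabla nS lam x B C' A * P.nablaConj nS lam x C B' A')

/-- The covector `Z_d{}^{[d}{}_{f]}`, whose raised form is `Z_d{}^{[df]}`. -/
def sparlingZTrace (P : SpinStructure g V S) (nS : CovariantDerivative (𝓡 4) V S)
    (lam : ∀ y, S y) (x : M) (w : TangentSpace (𝓡 4) x) : ℂ :=
  ∑ i, (sgn i : ℂ) * (1 / 2 * (P.sparlingZ nS lam x (g.frame x i) (g.frame x i) w
    - P.sparlingZ nS lam x (g.frame x i) w (g.frame x i)))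

end SpinStructure

end Spin

end Sparling

end

/-!
Read invariantly, the Nester–Witten form is
`F(u, v) = (i/2) (σ(u, ∇_v λ, λ) - σ(v, ∇_u λ, λ))` (`SpinStructure.nesterWittenForm_eq`), where
`σ(u, α, β) = u^a σ_{aAA'} α^A \bar β^{A'}`. Antisymmetry and smoothness are visible in this form.
Since `σ` is parallel and the connection is torsion free, the exterior derivative of `F` is the sum
of a curvature part, the cyclic sum of `-(i/2) σ(w, R(u,v)λ, λ)`, and a part that is quadratic in
`∇λ` (`IsSpinCovariantDerivative.antisymm_covDerivTwo_nesterWittenForm`). The right-hand side of the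
identity splits in the same way.

* The quadratic part is a pointwise identity between polynomials in the components of `∇λ`
  (`SpinStructure.sum_volumeForm_mul_sparlingZTrace`).
* For the curvature part, `ε` being parallel makes the curvature of `S` trace free, and `σ` being
  parallel makes it induce the Riemann tensor (`IsSpinCovariantDerivative.ε_curvature`,
  `IsSpinCovariantDerivative.σ_curvature`). The Einstein tensor is thereby a linear expression in
  the spin curvature, and the contraction of `η` with `G(ξ, ·)` agrees with the curvature part up to
  the cyclic sum of `R(u,v)w` (`det_einsteinForm`), which vanishes by the first Bianchi identity
  (`bundleCurvature_cyclic`). The result is `IsSpinCovariantDerivative.sum_volumeForm_mul_einstein`.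

The two facts about curvature rest on `mvfderiv_mlieBracket`, which says that the Lie bracket is the
commutator of derivations.

For the dominant property, a future-directed null vector is a nonnegative multiple of
`κ^A \bar κ^{A'}` (`SpinStructure.IsFutureNull.exists_spinor`), and on three such vectors `Z` is a
nonnegative multiple of `|κ_1^A κ_2^B \bar κ_3^{C'} ∇_{BC'} λ_A|²`
(`SpinStructure.sparlingZ_nonneg`).
-/

namespace Sparling

/-! ### Covariant derivatives of locally defined smooth sections -/

section Calculus

open Filter Topology

/-- The section `α` of the bundle `W` is smooth on the set `U`. -/
abbrev SmoothOn {M : Type*} [TopologicalSpace M] [ChartedSpace E4 M]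
    (F : Type*) [NormedAddCommGroup F] [NormedSpace ℝ F]
    {W : M → Type*} [TopologicalSpace (TotalSpace F W)] [∀ x, TopologicalSpace (W x)]
    [FiberBundle F W] (U : Set M) (α : ∀ y, W y) : Prop :=
  ContMDiffOn (𝓡 4) ((𝓡 4).prod 𝓘(ℝ, F)) ∞ (fun y => TotalSpace.mk' F y (α y)) U

variable {M : Type*} [TopologicalSpace M] [ChartedSpace E4 M]

theorem mvfderiv_clm_comp {E' : Type*} [NormedAddCommGroup E'] [NormedSpace ℝ E'] (L : ℂ →L[ℝ] E')
    {f : M → ℂ} {x : M} (hf : MDifferentiableAt (𝓡 4) 𝓘(ℝ, ℂ) f x) (v : TangentSpace (𝓡 4) x) :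
    mvfderiv (𝓡 4) (fun y => L (f y)) x v = L (mvfderiv (𝓡 4) f x v) := by
  have h := ((L.hasMFDerivAt (x := f x)).comp x hf.hasMFDerivAt).mfderiv
  simp only [mvfderiv]
  erw [h]
  rfl

theorem mvfderiv_re {f : M → ℂ} {x : M} (hf : MDifferentiableAt (𝓡 4) 𝓘(ℝ, ℂ) f x)
    (v : TangentSpace (𝓡 4) x) :
    mvfderiv (𝓡 4) (fun y => (f y).re) x v = (mvfderiv (𝓡 4) f x v).re :=
  mvfderiv_clm_comp Complex.reCLM hf v

theorem mvfderiv_im {f : M → ℂ} {x : M} (hf : MDifferentiableAt (𝓡 4) 𝓘(ℝ, ℂ) f x)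
    (v : TangentSpace (𝓡 4) x) :
    mvfderiv (𝓡 4) (fun y => (f y).im) x v = (mvfderiv (𝓡 4) f x v).im :=
  mvfderiv_clm_comp Complex.imCLM hf v

variable {F : Type*} [NormedAddCommGroup F] [NormedSpace ℝ F]
  {W : M → Type*} [TopologicalSpace (TotalSpace F W)] [∀ x, TopologicalSpace (W x)]
  [FiberBundle F W]

theorem SmoothOn.mdifferentiableAt {U : Set M} {α : ∀ y, W y} (hα : SmoothOn F U α)
    (hU : IsOpen U) {x : M} (hx : x ∈ U) :
    MDifferentiableAt (𝓡 4) ((𝓡 4).prod 𝓘(ℝ, F)) (fun y => TotalSpace.mk' F y (α y)) x :=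
  (hα.contMDiffAt (hU.mem_nhds hx)).mdifferentiableAt (by simp)

variable [IsManifold (𝓡 4) ∞ M] [∀ x, AddCommGroup (W x)] [∀ x, Module ℝ (W x)]
  [∀ x, IsTopologicalAddGroup (W x)] [∀ x, ContinuousSMul ℝ (W x)] [VectorBundle ℝ F W]

/-- `∇_X α` is smooth on an open set if `X` and `α` are. The smoothness of a covariant derivative is
assumed for global sections, so `α` is multiplied with a bump function. -/
theorem SmoothOn.covariantDerivative [T2Space M] [ContMDiffVectorBundle ∞ F W (𝓡 4)]
    {cov : CovariantDerivative (𝓡 4) F W}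
    (hcov : CovariantDerivative.ContMDiffCovariantDerivative cov ∞)
    {U : Set M} (hU : IsOpen U) {α : ∀ y, W y} (hα : SmoothOn F U α)
    {X : ∀ y : M, TangentSpace (𝓡 4) y} (hX : SmoothOn E4 U X) :
    SmoothOn F U (fun y => cov α y (X y)) := by
  intro x hx
  obtain ⟨ψ, -, hψ⟩ := ((SmoothBumpFunction.nhds_basis_tsupport (I := 𝓡 4) x).mem_iff).1
    (hU.mem_nhds hx)
  have hglob : ContMDiff (𝓡 4) ((𝓡 4).prod 𝓘(ℝ, F)) ∞
      (fun y => TotalSpace.mk' F y (((ψ : M → ℝ) • α) y)) :=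
    ContMDiffOn.smul_section_of_tsupport ψ.contMDiff.contMDiffOn hU hψ hα
  have h1 := hcov.contMDiff.contMDiff (σ := (ψ : M → ℝ) • α) (by
    rw [contMDiffOn_univ]; exact hglob)
  have h2 := (contMDiffOn_univ.1 h1) x
  have h3 := h2.clm_bundle_apply (hX.contMDiffAt (hU.mem_nhds hx))
  refine (h3.congr_of_eventuallyEq ?_).contMDiffWithinAt
  have hev : ∀ᶠ y in 𝓝 x, y ∈ U ∧ ∀ᶠ z in 𝓝 y, α z = ((ψ : M → ℝ) • α) z := by
    have h4 : ∀ᶠ z in 𝓝 x, α z = ((ψ : M → ℝ) • α) z := by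
      filter_upwards [ψ.eventuallyEq_one] with z hz
      simp [hz]
    exact Filter.Eventually.and (hU.mem_nhds hx) (eventually_eventually_nhds.2 h4)
  filter_upwards [hev] with y hy
  have hyψ := (hglob y).mdifferentiableAt (n := ∞) (by simp)
  have := cov.isCovariantDerivativeOnUniv.congr_of_eventuallyEq
    (hα.mdifferentiableAt hU hy.1) hyψ univ_mem hy.2
  simp only [this]

/-- The commutator of two derivations: if `k = X f` and `h = Y f` near `x`, then
`X h - Y k = [X, Y] f`. It follows from the Jacobi identity for `X`, `Y` and `f Z`, with `Z` a
vector field that does not vanish at `x`. -/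
theorem mvfderiv_mlieBracket_real {U : Set M} (hU : IsOpen U) {x : M} (hx : x ∈ U)
    {X Y : ∀ y : M, TangentSpace (𝓡 4) y} (hX : SmoothOn E4 U X) (hY : SmoothOn E4 U Y)
    {f h k : M → ℝ} (hf : ContMDiffOn (𝓡 4) 𝓘(ℝ, ℝ) ∞ f U)
    (hh : ContMDiffOn (𝓡 4) 𝓘(ℝ, ℝ) ∞ h U) (hk : ContMDiffOn (𝓡 4) 𝓘(ℝ, ℝ) ∞ k U)
    (hfk : ∀ y ∈ U, mvfderiv (𝓡 4) f y (X y) = k y)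
    (hfh : ∀ y ∈ U, mvfderiv (𝓡 4) f y (Y y) = h y) :
    mvfderiv (𝓡 4) h x (X x) - mvfderiv (𝓡 4) k x (Y x)
      = mvfderiv (𝓡 4) f x (VectorField.mlieBracket (𝓡 4) X Y x) := by
  have : IsManifold (𝓡 4) (minSmoothness ℝ 3) M := by
    rw [minSmoothness_of_isRCLikeNormedField]; infer_instance
  have : IsManifold (𝓡 4) 2 M := inferInstance
  have h2 : minSmoothness ℝ 2 ≤ (∞ : WithTop ℕ∞) := by
    rw [minSmoothness_of_isRCLikeNormedField]; exact ENat.LEInfty.out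
  have h2' : minSmoothness ℝ ((1 : ℕ∞) + 1) ≤ ((⊤ : ℕ∞) : WithTop ℕ∞) := by
    rw [minSmoothness_of_isRCLikeNormedField]
    exact_mod_cast (le_top : (1 : ℕ∞) + 1 ≤ ⊤)
  have : IsManifold (𝓡 4) (((⊤ : ℕ∞) : WithTop ℕ∞) + 1) M :=
    inferInstanceAs (IsManifold (𝓡 4) ∞ M)
  have hxU := hU.mem_nhds hx
  obtain ⟨w, hw⟩ : ∃ w : TangentSpace (𝓡 4) x, w ≠ 0 :=
    ⟨(EuclideanSpace.single 0 1 : E4), by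
      change (EuclideanSpace.single 0 1 : E4) ≠ 0
      simp⟩
  obtain ⟨Z, rfl, U', hU', hxU', hZ⟩ : ∃ Z : ∀ y : M, TangentSpace (𝓡 4) y, Z x = w ∧
      ∃ U' : Set M, IsOpen U' ∧ x ∈ U' ∧ SmoothOn E4 U' Z := by
    obtain ⟨s, hs, hsZ⟩ := FiberBundle.exists_contMDiffOn_extend (k := ∞) (𝓡 4) E4 w
    obtain ⟨U', h1, h2, h3⟩ := mem_nhds_iff.1 hs
    exact ⟨FiberBundle.extend E4 w, FiberBundle.extend_apply_self E4 w, U', h2, h3, hsZ.mono h1⟩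
  have hZx := hZ.contMDiffAt (hU'.mem_nhds hxU')
  have hXx := hX.contMDiffAt hxU
  have hYx := hY.contMDiffAt hxU
  have hfx := hf.contMDiffAt hxU
  have hfd : ∀ y ∈ U, MDifferentiableAt (𝓡 4) 𝓘(ℝ, ℝ) f y := fun y hy =>
    (hf.contMDiffAt (hU.mem_nhds hy)).mdifferentiableAt (by simp)
  have hhd := (hh.contMDiffAt hxU).mdifferentiableAt (n := ∞) (by simp)
  have hkd := (hk.contMDiffAt hxU).mdifferentiableAt (n := ∞) (by simp)
  have hUU : ∀ᶠ y in 𝓝 x, y ∈ U ∧ y ∈ U' := Filter.Eventually.and hxU (hU'.mem_nhds hxU')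
  -- brackets of smooth fields are differentiable at `x`
  have hbr : ∀ A : ∀ y : M, TangentSpace (𝓡 4) y,
      ContMDiffAt (𝓡 4) ((𝓡 4).prod 𝓘(ℝ, E4)) ∞ (fun y => TotalSpace.mk' E4 y (A y)) x →
      MDifferentiableAt (𝓡 4) ((𝓡 4).prod 𝓘(ℝ, E4))
        (fun y => TotalSpace.mk' E4 y (VectorField.mlieBracket (𝓡 4) A Z y)) x := fun A hA =>
    ContMDiffAt.mdifferentiableAt (n := ((1 : ℕ∞) : WithTop ℕ∞))
      (ContMDiffAt.mlieBracket_vectorField (m := 1) (n := ⊤) hA hZx h2') (by simp)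
  have hfbr : ∀ A : ∀ y : M, TangentSpace (𝓡 4) y, ∀ l : M → ℝ,
      (∀ y ∈ U, mvfderiv (𝓡 4) f y (A y) = l y) →
      VectorField.mlieBracket (𝓡 4) A (f • Z) =ᶠ[𝓝 x]
        l • Z + f • VectorField.mlieBracket (𝓡 4) A Z := by
    intro A l hl
    filter_upwards [hUU] with y hy
    rw [VectorField.mlieBracket_smul_right (hfd y hy.1) (hZ.mdifferentiableAt hU' hy.2),
      hl y hy.1]
    rfl
  have hZd := hZ.mdifferentiableAt hU' hxU'
  have expand : ∀ A B : ∀ y : M, TangentSpace (𝓡 4) y, ∀ l : M → ℝ,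
      MDifferentiableAt (𝓡 4) 𝓘(ℝ, ℝ) l x →
      (∀ y ∈ U, mvfderiv (𝓡 4) f y (A y) = l y) →
      ContMDiffAt (𝓡 4) ((𝓡 4).prod 𝓘(ℝ, E4)) ∞ (fun y => TotalSpace.mk' E4 y (A y)) x →
      VectorField.mlieBracket (𝓡 4) B (VectorField.mlieBracket (𝓡 4) A (f • Z)) x
        = mvfderiv (𝓡 4) l x (B x) • Z x + l x • VectorField.mlieBracket (𝓡 4) B Z x
          + (mvfderiv (𝓡 4) f x (B x) • VectorField.mlieBracket (𝓡 4) A Z x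
            + f x • VectorField.mlieBracket (𝓡 4) B (VectorField.mlieBracket (𝓡 4) A Z) x) := by
    intro A B l hld hl hA
    rw [(EventuallyEq.refl _ B).mlieBracket_vectorField_eq (hfbr A l hl),
      VectorField.mlieBracket_add_right (hld.smul_section hZd) ((hfd x hx).smul_section (hbr A hA)),
      VectorField.mlieBracket_smul_right hld hZd,
      VectorField.mlieBracket_smul_right (hfd x hx) (hbr A hA)]
  have J1 := VectorField.leibniz_identity_mlieBracket_apply (hXx.of_le h2) (hYx.of_le h2)
    ((hfx.smul_section hZx).of_le h2)
  have J2 := VectorField.leibniz_identity_mlieBracket_apply (hXx.of_le h2) (hYx.of_le h2)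
    (hZx.of_le h2)
  rw [expand Y X h hhd hfh hYx, expand X Y k hkd hfk hXx,
    VectorField.mlieBracket_smul_right (hfd x hx) hZd, J2, hfk x hx, hfh x hx] at J1
  have J3 : (mvfderiv (𝓡 4) h x (X x) - mvfderiv (𝓡 4) k x (Y x)
      - mvfderiv (𝓡 4) f x (VectorField.mlieBracket (𝓡 4) X Y x)) • Z x = 0 := by
    rw [← sub_eq_zero] at J1
    rw [← J1]
    module
  have := (smul_eq_zero.1 J3).resolve_right hw
  linarith

/-- The complex valued form of `mvfderiv_mlieBracket_real`. -/
theorem mvfderiv_mlieBracket {U : Set M} (hU : IsOpen U) {x : M} (hx : x ∈ U)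
    {X Y : ∀ y : M, TangentSpace (𝓡 4) y} (hX : SmoothOn E4 U X) (hY : SmoothOn E4 U Y)
    {f h k : M → ℂ} (hf : ContMDiffOn (𝓡 4) 𝓘(ℝ, ℂ) ∞ f U)
    (hh : ContMDiffOn (𝓡 4) 𝓘(ℝ, ℂ) ∞ h U) (hk : ContMDiffOn (𝓡 4) 𝓘(ℝ, ℂ) ∞ k U)
    (hfk : ∀ y ∈ U, mvfderiv (𝓡 4) f y (X y) = k y)
    (hfh : ∀ y ∈ U, mvfderiv (𝓡 4) f y (Y y) = h y) :
    mvfderiv (𝓡 4) h x (X x) - mvfderiv (𝓡 4) k x (Y x)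
      = mvfderiv (𝓡 4) f x (VectorField.mlieBracket (𝓡 4) X Y x) := by
  have diff : ∀ {l : M → ℂ}, ContMDiffOn (𝓡 4) 𝓘(ℝ, ℂ) ∞ l U → ∀ y ∈ U,
      MDifferentiableAt (𝓡 4) 𝓘(ℝ, ℂ) l y := fun hl y hy =>
    (hl.contMDiffAt (hU.mem_nhds hy)).mdifferentiableAt (by simp)
  have re : ∀ {l : M → ℂ}, ContMDiffOn (𝓡 4) 𝓘(ℝ, ℂ) ∞ l U →
      ContMDiffOn (𝓡 4) 𝓘(ℝ, ℝ) ∞ (fun y => (l y).re) U := fun hl =>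
    Complex.reCLM.contMDiff.comp_contMDiffOn hl
  have im : ∀ {l : M → ℂ}, ContMDiffOn (𝓡 4) 𝓘(ℝ, ℂ) ∞ l U →
      ContMDiffOn (𝓡 4) 𝓘(ℝ, ℝ) ∞ (fun y => (l y).im) U := fun hl =>
    Complex.imCLM.contMDiff.comp_contMDiffOn hl
  apply Complex.ext
  · have := mvfderiv_mlieBracket_real hU hx hX hY (re hf) (re hh) (re hk)
      (fun y hy => by rw [mvfderiv_re (diff hf y hy), hfk y hy])
      (fun y hy => by rw [mvfderiv_re (diff hf y hy), hfh y hy])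
    rwa [mvfderiv_re (diff hf x hx), mvfderiv_re (diff hh x hx), mvfderiv_re (diff hk x hx)] at this
  · have := mvfderiv_mlieBracket_real hU hx hX hY (im hf) (im hh) (im hk)
      (fun y hy => by rw [mvfderiv_im (diff hf y hy), hfk y hy])
      (fun y hy => by rw [mvfderiv_im (diff hf y hy), hfh y hy])
    rwa [mvfderiv_im (diff hf x hx), mvfderiv_im (diff hh x hx), mvfderiv_im (diff hk x hx)] at this

end Calculus
/-! ### The curvature operator -/

section Curvature

open Filter Topology

variable {M : Type*} [TopologicalSpace M] [ChartedSpace E4 M]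
  {F : Type*} [NormedAddCommGroup F] [NormedSpace ℝ F]
  {W : M → Type*} [TopologicalSpace (TotalSpace F W)]
  [∀ x, AddCommGroup (W x)] [∀ x, Module ℝ (W x)] [∀ x, TopologicalSpace (W x)]
  [∀ x, IsTopologicalAddGroup (W x)] [∀ x, ContinuousSMul ℝ (W x)]
  [FiberBundle F W]

/-- The curvature operator `R(X,Y)α = ∇_X ∇_Y α - ∇_Y ∇_X α - ∇_{[X,Y]} α` of a covariant
derivative on a vector bundle. -/
noncomputable def bundleCurvature (cov : CovariantDerivative (𝓡 4) F W)
    (X Y : ∀ y : M, TangentSpace (𝓡 4) y) (α : ∀ y, W y) (x : M) : W x :=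
  cov (fun y => cov α y (Y y)) x (X x) - cov (fun y => cov α y (X y)) x (Y x)
    - cov α x (VectorField.mlieBracket (𝓡 4) X Y x)

theorem bundleCurvature_swap (cov : CovariantDerivative (𝓡 4) F W)
    (X Y : ∀ y : M, TangentSpace (𝓡 4) y) (α : ∀ y, W y) (x : M) :
    bundleCurvature cov Y X α x = -bundleCurvature cov X Y α x := by
  simp only [bundleCurvature]
  rw [VectorField.mlieBracket_swap_apply (V := Y), map_neg]
  abel

variable [IsManifold (𝓡 4) ∞ M] [VectorBundle ℝ F W] [T2Space M] [ContMDiffVectorBundle ∞ F W (𝓡 4)]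
  {cov : CovariantDerivative (𝓡 4) F W} {U : Set M} {x : M}

theorem bundleCurvature_congr_left
    (hcov : CovariantDerivative.ContMDiffCovariantDerivative cov ∞)
    (hU : IsOpen U) (hx : x ∈ U) {X X' Y : ∀ y : M, TangentSpace (𝓡 4) y} {α : ∀ y, W y}
    (hX : SmoothOn E4 U X) (hX' : SmoothOn E4 U X') (hα : SmoothOn F U α)
    (h : ∀ y ∈ U, X y = X' y) :
    bundleCurvature cov X Y α x = bundleCurvature cov X' Y α x := by
  have hev : ∀ᶠ y in 𝓝 x, X y = X' y := by
    filter_upwards [hU.mem_nhds hx] with y hy using h y hy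
  have hev' : ∀ᶠ y in 𝓝 x, cov α y (X y) = cov α y (X' y) := by
    filter_upwards [hev] with y hy
    rw [hy]
  simp only [bundleCurvature]
  rw [h x hx, Filter.EventuallyEq.mlieBracket_vectorField_eq hev (EventuallyEq.refl _ Y),
    cov.isCovariantDerivativeOnUniv.congr_of_eventuallyEq
      ((hα.covariantDerivative hcov hU hX).mdifferentiableAt hU hx)
      ((hα.covariantDerivative hcov hU hX').mdifferentiableAt hU hx) univ_mem hev']

theorem bundleCurvature_add_left
    (hcov : CovariantDerivative.ContMDiffCovariantDerivative cov ∞)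
    (hU : IsOpen U) (hx : x ∈ U) {X X' Y : ∀ y : M, TangentSpace (𝓡 4) y} {α : ∀ y, W y}
    (hX : SmoothOn E4 U X) (hX' : SmoothOn E4 U X') (hα : SmoothOn F U α) :
    bundleCurvature cov (X + X') Y α x
      = bundleCurvature cov X Y α x + bundleCurvature cov X' Y α x := by
  have : IsManifold (𝓡 4) 2 M := inferInstance
  have h1 : (fun y => cov α y ((X + X') y))
      = (fun y => cov α y (X y)) + (fun y => cov α y (X' y)) := by
    funext y
    simp only [Pi.add_apply, map_add]
  simp only [bundleCurvature]
  rw [h1, cov.isCovariantDerivativeOnUniv.add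
      ((hα.covariantDerivative hcov hU hX).mdifferentiableAt hU hx)
      ((hα.covariantDerivative hcov hU hX').mdifferentiableAt hU hx),
    VectorField.mlieBracket_add_left (hX.mdifferentiableAt hU hx) (hX'.mdifferentiableAt hU hx)]
  simp only [Pi.add_apply, map_add, add_apply]
  abel

theorem bundleCurvature_smul_left
    (hcov : CovariantDerivative.ContMDiffCovariantDerivative cov ∞)
    (hU : IsOpen U) (hx : x ∈ U) (c : ℝ) {X Y : ∀ y : M, TangentSpace (𝓡 4) y} {α : ∀ y, W y}
    (hX : SmoothOn E4 U X) (hα : SmoothOn F U α) :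
    bundleCurvature cov (c • X) Y α x = c • bundleCurvature cov X Y α x := by
  have : IsManifold (𝓡 4) 2 M := inferInstance
  have h1 : (fun y => cov α y ((c • X) y)) = c • (fun y => cov α y (X y)) := by
    funext y
    simp only [Pi.smul_apply, map_smul]
  simp only [bundleCurvature]
  rw [h1, cov.isCovariantDerivativeOnUniv.smul_const c
      ((hα.covariantDerivative hcov hU hX).mdifferentiableAt hU hx),
    VectorField.mlieBracket_const_smul_left (hX.mdifferentiableAt hU hx)]
  simp only [Pi.smul_apply, map_smul, smul_apply, smul_sub]

/-- The first Bianchi identity of a torsion-free connection. -/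
theorem bundleCurvature_cyclic
    {nT : CovariantDerivative (𝓡 4) E4 (TangentSpace (𝓡 4) : M → Type _)}
    (hnT : CovariantDerivative.ContMDiffCovariantDerivative nT ∞) (htor : nT.torsion = 0)
    (hU : IsOpen U) (hx : x ∈ U) {X Y Z : ∀ y : M, TangentSpace (𝓡 4) y}
    (hX : SmoothOn E4 U X) (hY : SmoothOn E4 U Y) (hZ : SmoothOn E4 U Z) :
    bundleCurvature nT X Y Z x + bundleCurvature nT Y Z X x + bundleCurvature nT Z X Y x = 0 := by
  have : IsManifold (𝓡 4) (minSmoothness ℝ 3) M := by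
    rw [minSmoothness_of_isRCLikeNormedField]; infer_instance
  have : IsManifold (𝓡 4) (((⊤ : ℕ∞) : WithTop ℕ∞) + 1) M :=
    inferInstanceAs (IsManifold (𝓡 4) ∞ M)
  have h2 : minSmoothness ℝ 2 ≤ (∞ : WithTop ℕ∞) := by
    rw [minSmoothness_of_isRCLikeNormedField]; exact ENat.LEInfty.out
  have h2' : minSmoothness ℝ ((1 : ℕ∞) + 1) ≤ ((⊤ : ℕ∞) : WithTop ℕ∞) := by
    rw [minSmoothness_of_isRCLikeNormedField]
    exact_mod_cast (le_top : (1 : ℕ∞) + 1 ≤ ⊤)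
  have tf : ∀ {A B : ∀ y : M, TangentSpace (𝓡 4) y} {y : M},
      MDifferentiableAt (𝓡 4) ((𝓡 4).prod 𝓘(ℝ, E4)) (fun y => TotalSpace.mk' E4 y (A y)) y →
      MDifferentiableAt (𝓡 4) ((𝓡 4).prod 𝓘(ℝ, E4)) (fun y => TotalSpace.mk' E4 y (B y)) y →
      nT B y (A y) - nT A y (B y) = VectorField.mlieBracket (𝓡 4) A B y :=
    fun hA hB => nT.torsion_eq_zero_iff.1 htor hA hB
  have hxU := hU.mem_nhds hx
  -- `∇_A ∇_B C - ∇_A ∇_C B = ∇_A [B, C] = ∇_{[B,C]} A + [A, [B, C]]`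
  have key : ∀ A B C : ∀ y : M, TangentSpace (𝓡 4) y,
      SmoothOn E4 U A → SmoothOn E4 U B → SmoothOn E4 U C →
      nT (fun y => nT C y (B y)) x (A x) - nT (fun y => nT B y (C y)) x (A x)
        = nT A x (VectorField.mlieBracket (𝓡 4) B C x)
          + VectorField.mlieBracket (𝓡 4) A (VectorField.mlieBracket (𝓡 4) B C) x := by
    intro A B C hA hB hC
    have hBC := (hC.covariantDerivative hnT hU hB).mdifferentiableAt hU hx
    have hCB := (hB.covariantDerivative hnT hU hC).mdifferentiableAt hU hx
    have hbr : MDifferentiableAt (𝓡 4) ((𝓡 4).prod 𝓘(ℝ, E4))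
        (fun y => TotalSpace.mk' E4 y (VectorField.mlieBracket (𝓡 4) B C y)) x :=
      ContMDiffAt.mdifferentiableAt (n := ((1 : ℕ∞) : WithTop ℕ∞))
        (ContMDiffAt.mlieBracket_vectorField (m := 1) (n := ⊤) (hB.contMDiffAt hxU)
          (hC.contMDiffAt hxU) h2') (by simp)
    have hsum : MDifferentiableAt (𝓡 4) ((𝓡 4).prod 𝓘(ℝ, E4))
        (fun y => TotalSpace.mk' E4 y
          (((fun y => nT B y (C y)) + VectorField.mlieBracket (𝓡 4) B C) y)) x :=
      mdifferentiableAt_add_section hCB hbr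
    have hev : ∀ᶠ y in 𝓝 x, nT C y (B y)
        = ((fun y => nT B y (C y)) + VectorField.mlieBracket (𝓡 4) B C) y := by
      filter_upwards [hxU] with y hy
      rw [Pi.add_apply, ← tf (hB.mdifferentiableAt hU hy) (hC.mdifferentiableAt hU hy)]
      abel
    rw [nT.isCovariantDerivativeOnUniv.congr_of_eventuallyEq hBC hsum univ_mem hev,
      nT.isCovariantDerivativeOnUniv.add hCB hbr, ← tf (hA.mdifferentiableAt hU hx) hbr]
    simp only [add_apply]
    abel
  have J := VectorField.leibniz_identity_mlieBracket_apply ((hX.contMDiffAt hxU).of_le h2)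
    ((hY.contMDiffAt hxU).of_le h2) ((hZ.contMDiffAt hxU).of_le h2)
  have k1 := key X Y Z hX hY hZ
  have k2 := key Y Z X hY hZ hX
  have k3 := key Z X Y hZ hX hY
  rw [J] at k1
  rw [VectorField.mlieBracket_swap (V := Z) (W := X)] at k2
  rw [VectorField.mlieBracket_swap_apply (V := Z)] at k3
  have hneg : VectorField.mlieBracket (𝓡 4) Y (-VectorField.mlieBracket (𝓡 4) X Z) x
      = -VectorField.mlieBracket (𝓡 4) Y (VectorField.mlieBracket (𝓡 4) X Z) x := by
    have hXZ : MDifferentiableAt (𝓡 4) ((𝓡 4).prod 𝓘(ℝ, E4))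
        (fun y => TotalSpace.mk' E4 y (VectorField.mlieBracket (𝓡 4) X Z y)) x :=
      ContMDiffAt.mdifferentiableAt (n := ((1 : ℕ∞) : WithTop ℕ∞))
        (ContMDiffAt.mlieBracket_vectorField (m := 1) (n := ⊤) (hX.contMDiffAt hxU)
          (hZ.contMDiffAt hxU) h2') (by simp)
    have := VectorField.mlieBracket_const_smul_right (I := 𝓡 4) (V := Y) (c := (-1 : ℝ)) hXZ
    simpa using this
  rw [hneg] at k2
  simp only [bundleCurvature]
  rw [VectorField.mlieBracket_swap_apply (V := Z) (W := X)]
  simp only [Pi.neg_apply, map_neg] at k1 k2 k3 ⊢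
  have := congrArg₂ (· + ·) (congrArg₂ (· + ·) k1 k2) k3
  rw [← sub_eq_zero] at this
  rw [← this]
  abel

end Curvature
/-! ### Curvature of the spin connection -/

section SpinCurvature

variable {M : Type*} [TopologicalSpace M] [ChartedSpace E4 M]
  [IsManifold (𝓡 4) ∞ M] {g : LorentzMetric M}
  {V : Type*} [NormedAddCommGroup V] [NormedSpace ℂ V]
  {S : M → Type*} [TopologicalSpace (TotalSpace V S)]
  [∀ x, AddCommGroup (S x)] [∀ x, Module ℂ (S x)] [∀ x, TopologicalSpace (S x)]
  [FiberBundle V S] {P : SpinStructure g V S}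
  {U : Set M} {x : M} {X Y Z : ∀ y : M, TangentSpace (𝓡 4) y} {α β : ∀ y, S y}

theorem SpinStructure.contMDiffOn_σ (P : SpinStructure g V S) (hU : IsOpen U)
    (hZ : SmoothOn E4 U Z) (hα : SmoothOn V U α) (hβ : SmoothOn V U β) :
    ContMDiffOn (𝓡 4) 𝓘(ℝ, ℂ) ∞ (fun y => P.σ y (Z y) (α y) (β y)) U := fun y hy =>
  (P.σ_smooth y Z α β (hZ.contMDiffAt (hU.mem_nhds hy)) (hα.contMDiffAt (hU.mem_nhds hy))
    (hβ.contMDiffAt (hU.mem_nhds hy))).contMDiffWithinAt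

variable [T2Space M] [∀ x, IsTopologicalAddGroup (S x)] [∀ x, ContinuousSMul ℝ (S x)]
  [VectorBundle ℝ V S] [ContMDiffVectorBundle ∞ V S (𝓡 4)]
  {nT : CovariantDerivative (𝓡 4) E4 (TangentSpace (𝓡 4) : M → Type _)}
  {nS : CovariantDerivative (𝓡 4) V S}

/-- The curvature acts on the soldering form as a derivation, and the soldering form is parallel. -/
theorem IsSpinCovariantDerivative.σ_curvature (hn : IsSpinCovariantDerivative P nT nS)
    (hU : IsOpen U) (hx : x ∈ U)
    (hX : SmoothOn E4 U X) (hY : SmoothOn E4 U Y) (hZ : SmoothOn E4 U Z)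
    (hα : SmoothOn V U α) (hβ : SmoothOn V U β) :
    P.σ x (bundleCurvature nT X Y Z x) (α x) (β x)
      + P.σ x (Z x) (bundleCurvature nS X Y α x) (β x)
      + P.σ x (Z x) (α x) (bundleCurvature nS X Y β x) = 0 := by
  have hT := hn.smooth_tangent
  have hS := hn.smooth_spin
  have sm : ∀ {A : ∀ y : M, TangentSpace (𝓡 4) y}, SmoothOn E4 U A →
      ContMDiffOn (𝓡 4) 𝓘(ℝ, ℂ) ∞ (fun y => P.σ y (nT Z y (A y)) (α y) (β y)) U
      ∧ ContMDiffOn (𝓡 4) 𝓘(ℝ, ℂ) ∞ (fun y => P.σ y (Z y) (nS α y (A y)) (β y)) U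
      ∧ ContMDiffOn (𝓡 4) 𝓘(ℝ, ℂ) ∞ (fun y => P.σ y (Z y) (α y) (nS β y (A y))) U :=
    fun hA => ⟨P.contMDiffOn_σ hU (hZ.covariantDerivative hT hU hA) hα hβ,
      P.contMDiffOn_σ hU hZ (hα.covariantDerivative hS hU hA) hβ,
      P.contMDiffOn_σ hU hZ hα (hβ.covariantDerivative hS hU hA)⟩
  have dZ := hZ.mdifferentiableAt hU hx
  have dα := hα.mdifferentiableAt hU hx
  have dβ := hβ.mdifferentiableAt hU hx
  have dd : ∀ {l : M → ℂ}, ContMDiffOn (𝓡 4) 𝓘(ℝ, ℂ) ∞ l U →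
      MDifferentiableAt (𝓡 4) 𝓘(ℝ, ℂ) l x := fun hl =>
    (hl.contMDiffAt (hU.mem_nhds hx)).mdifferentiableAt (by simp)
  -- second derivatives of `σ(Z, α, β)`
  have second : ∀ {A B : ∀ y : M, TangentSpace (𝓡 4) y}, SmoothOn E4 U A →
      mvfderiv (𝓡 4) (fun y => P.σ y (nT Z y (A y)) (α y) (β y)
        + P.σ y (Z y) (nS α y (A y)) (β y) + P.σ y (Z y) (α y) (nS β y (A y))) x (B x)
      = P.σ x (nT (fun y => nT Z y (A y)) x (B x)) (α x) (β x)
        + P.σ x (nT Z x (A x)) (nS α x (B x)) (β x) + P.σ x (nT Z x (A x)) (α x) (nS β x (B x))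
        + (P.σ x (nT Z x (B x)) (nS α x (A x)) (β x)
          + P.σ x (Z x) (nS (fun y => nS α y (A y)) x (B x)) (β x)
          + P.σ x (Z x) (nS α x (A x)) (nS β x (B x)))
        + (P.σ x (nT Z x (B x)) (α x) (nS β x (A x)) + P.σ x (Z x) (nS α x (B x)) (nS β x (A x))
          + P.σ x (Z x) (α x) (nS (fun y => nS β y (A y)) x (B x))) := by
    intro A B hA
    obtain ⟨s1, s2, s3⟩ := sm hA
    have e1 := hn.σ_parallel x (fun y => nT Z y (A y)) α β (B x)
      ((hZ.covariantDerivative hT hU hA).mdifferentiableAt hU hx) dα dβ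
    have e2 := hn.σ_parallel x Z (fun y => nS α y (A y)) β (B x) dZ
      ((hα.covariantDerivative hS hU hA).mdifferentiableAt hU hx) dβ
    have e3 := hn.σ_parallel x Z α (fun y => nS β y (A y)) (B x) dZ dα
      ((hβ.covariantDerivative hS hU hA).mdifferentiableAt hU hx)
    have d12 : MDifferentiableAt (𝓡 4) 𝓘(ℝ, ℂ) (fun y => P.σ y (nT Z y (A y)) (α y) (β y)
        + P.σ y (Z y) (nS α y (A y)) (β y)) x := (dd s1).add (dd s2)
    rw [mvfderiv_fun_add d12 (dd s3), mvfderiv_fun_add (dd s1) (dd s2),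
      add_apply, add_apply, e1, e2, e3]
  have main := mvfderiv_mlieBracket hU hx hX hY (P.contMDiffOn_σ hU hZ hα hβ)
    (((sm hY).1.add (sm hY).2.1).add (sm hY).2.2) (((sm hX).1.add (sm hX).2.1).add (sm hX).2.2)
    (fun y hy => hn.σ_parallel y Z α β (X y) (hZ.mdifferentiableAt hU hy)
      (hα.mdifferentiableAt hU hy) (hβ.mdifferentiableAt hU hy))
    (fun y hy => hn.σ_parallel y Z α β (Y y) (hZ.mdifferentiableAt hU hy)
      (hα.mdifferentiableAt hU hy) (hβ.mdifferentiableAt hU hy))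
  have m1 := second (B := X) hY
  have m2 := second (B := Y) hX
  have m3 := hn.σ_parallel x Z α β (VectorField.mlieBracket (𝓡 4) X Y x) dZ dα dβ
  erw [m1, m2, m3] at main
  simp only [bundleCurvature, map_sub, LinearMap.sub_apply]
  linear_combination main

/-- The curvature of the spin connection is traceless. -/
theorem IsSpinCovariantDerivative.ε_curvature (hn : IsSpinCovariantDerivative P nT nS)
    (hU : IsOpen U) (hx : x ∈ U) (hX : SmoothOn E4 U X) (hY : SmoothOn E4 U Y)
    (hα : SmoothOn V U α) (hβ : SmoothOn V U β) :
    P.ε x (bundleCurvature nS X Y α x) (β x) + P.ε x (α x) (bundleCurvature nS X Y β x) = 0 := by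
  have hS := hn.smooth_spin
  have smε : ∀ {γ δ : ∀ y, S y}, SmoothOn V U γ → SmoothOn V U δ →
      ContMDiffOn (𝓡 4) 𝓘(ℝ, ℂ) ∞ (fun y => P.ε y (γ y) (δ y)) U := fun hγ hδ y hy =>
    (P.ε_smooth y _ _ (hγ.contMDiffAt (hU.mem_nhds hy))
      (hδ.contMDiffAt (hU.mem_nhds hy))).contMDiffWithinAt
  have dα := hα.mdifferentiableAt hU hx
  have dβ := hβ.mdifferentiableAt hU hx
  have dd : ∀ {l : M → ℂ}, ContMDiffOn (𝓡 4) 𝓘(ℝ, ℂ) ∞ l U →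
      MDifferentiableAt (𝓡 4) 𝓘(ℝ, ℂ) l x := fun hl =>
    (hl.contMDiffAt (hU.mem_nhds hx)).mdifferentiableAt (by simp)
  have sm : ∀ {A : ∀ y : M, TangentSpace (𝓡 4) y}, SmoothOn E4 U A →
      ContMDiffOn (𝓡 4) 𝓘(ℝ, ℂ) ∞ (fun y => P.ε y (nS α y (A y)) (β y)) U
      ∧ ContMDiffOn (𝓡 4) 𝓘(ℝ, ℂ) ∞ (fun y => P.ε y (α y) (nS β y (A y))) U :=
    fun hA => ⟨smε (hα.covariantDerivative hS hU hA) hβ, smε hα (hβ.covariantDerivative hS hU hA)⟩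
  have second : ∀ {A B : ∀ y : M, TangentSpace (𝓡 4) y}, SmoothOn E4 U A →
      mvfderiv (𝓡 4) (fun y => P.ε y (nS α y (A y)) (β y) + P.ε y (α y) (nS β y (A y))) x (B x)
      = P.ε x (nS (fun y => nS α y (A y)) x (B x)) (β x) + P.ε x (nS α x (A x)) (nS β x (B x))
        + (P.ε x (nS α x (B x)) (nS β x (A x))
          + P.ε x (α x) (nS (fun y => nS β y (A y)) x (B x))) := by
    intro A B hA
    have e2 := hn.ε_parallel x (fun y => nS α y (A y)) β (B x)
      ((hα.covariantDerivative hS hU hA).mdifferentiableAt hU hx) dβ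
    have e3 := hn.ε_parallel x α (fun y => nS β y (A y)) (B x) dα
      ((hβ.covariantDerivative hS hU hA).mdifferentiableAt hU hx)
    rw [mvfderiv_fun_add (dd (sm hA).1) (dd (sm hA).2), add_apply, e2, e3]
  have main := mvfderiv_mlieBracket hU hx hX hY (smε hα hβ)
    ((sm hY).1.add (sm hY).2) ((sm hX).1.add (sm hX).2)
    (fun y hy => hn.ε_parallel y α β (X y) (hα.mdifferentiableAt hU hy)
      (hβ.mdifferentiableAt hU hy))
    (fun y hy => hn.ε_parallel y α β (Y y) (hα.mdifferentiableAt hU hy)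
      (hβ.mdifferentiableAt hU hy))
  have m1 := second (B := X) hY
  have m2 := second (B := Y) hX
  have m3 := hn.ε_parallel x α β (VectorField.mlieBracket (𝓡 4) X Y x) dα dβ
  erw [m1, m2, m3] at main
  simp only [bundleCurvature, map_sub, LinearMap.sub_apply]
  linear_combination main

end SpinCurvature
/-! ### Components of tensors and spinors at a point -/

section Components

variable {M : Type*} [TopologicalSpace M] [ChartedSpace E4 M] [IsManifold (𝓡 4) ∞ M]
  {g : LorentzMetric M}
  {V : Type*} [NormedAddCommGroup V] [NormedSpace ℂ V]
  {S : M → Type*} [TopologicalSpace (TotalSpace V S)]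
  [∀ x, AddCommGroup (S x)] [∀ x, Module ℂ (S x)] [∀ x, TopologicalSpace (S x)]
  [FiberBundle V S]

theorem conj_epsUp (A B : Fin 2) : conj (epsUp A B) = epsUp A B := by
  fin_cases A <;> fin_cases B <;> simp [epsUp]

theorem sgn_mul_self (i : Fin 4) : sgn i * sgn i = 1 := by
  fin_cases i <;> simp [sgn]

theorem LorentzMetric.repr_frame (g : LorentzMetric M) (x : M)
    (u : TangentSpace (𝓡 4) x) (i : Fin 4) :
    (g.frame x).repr u i = sgn i * g.val x u (g.frame x i) := by
  conv_rhs => rw [← (g.frame x).sum_repr u]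
  simp only [map_sum, map_smul, sum_apply, smul_apply,
    g.frame_isOrthonormal x _ i, smul_eq_mul, mul_ite, mul_zero, Finset.sum_ite_eq',
    Finset.mem_univ, if_true]
  linear_combination -((g.frame x).repr u i) * sgn_mul_self i

namespace SpinStructure

variable (P : SpinStructure g V S) (x : M)

theorem ε_swap (α β : S x) : P.ε x α β = -P.ε x β α := by
  have h := P.ε_alt x (α + β)
  simp only [map_add, LinearMap.add_apply, P.ε_alt] at h
  linear_combination h

theorem ε_spinFrame (A B : Fin 2) :
    P.ε x (P.spinFrame x A) (P.spinFrame x B) = epsUp A B := by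
  have h := P.spinFrame_spec x
  fin_cases A <;> fin_cases B <;> simp [epsUp, P.ε_alt, h]
  rw [P.ε_swap, h]

theorem sigLow_add (u v : TangentSpace (𝓡 4) x) (A B : Fin 2) :
    P.sigLow x (u + v) A B = P.sigLow x u A B + P.sigLow x v A B := by
  simp [sigLow]

theorem sigLow_conj (u : TangentSpace (𝓡 4) x) (A B : Fin 2) :
    conj (P.sigLow x u A B) = P.sigLow x u B A := by
  simp only [sigLow]
  rw [P.σ_hermitian x u (P.spinFrame x B)]

theorem sigLow_sum {ι : Type*} (s : Finset ι) (c : ι → ℝ) (u : ι → TangentSpace (𝓡 4) x)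
    (A B : Fin 2) :
    P.sigLow x (∑ i ∈ s, c i • u i) A B = ∑ i ∈ s, (c i : ℂ) * P.sigLow x (u i) A B := by
  simp [sigLow]

/-- The soldering form at `x` is a complete system: `σ^a_{AA'} σ_{aBB'} = ε_{BA} ε_{B'A'}` in
components. -/
theorem sigLow_complete (A A' B B' : Fin 2) :
    ∑ i, (sgn i : ℂ) * (P.sigLow x (g.frame x i) A A' * P.sigLow x (g.frame x i) B B')
      = epsUp B A * epsUp B' A' := by
  have h := P.σ_contract_tensor x (g.frame x) (g.frame_isOrthonormal x) (P.spinFrame x A)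
    (P.spinFrame x A') (P.spinFrame x B) (P.spinFrame x B')
  rw [P.ε_spinFrame, P.ε_spinFrame, conj_epsUp] at h
  exact h

/-- The polarized determinant: the metric in terms of the components `v^a σ_{aAA'}`. -/
theorem val_eq (u v : TangentSpace (𝓡 4) x) :
    (g.val x u v : ℂ) = P.sigLow x u 0 0 * P.sigLow x v 1 1 + P.sigLow x u 1 1 * P.sigLow x v 0 0
      - P.sigLow x u 0 1 * P.sigLow x v 1 0 - P.sigLow x u 1 0 * P.sigLow x v 0 1 := by
  have h := P.σ_contract_spinor x (P.spinFrame x) (P.spinFrame_spec x) u v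
  rw [← h]
  simp only [Fin.sum_univ_two, epsUp, sigLow]
  simp
  ring

/-- The components `f_{AA'} = σ^a_{AA'} f_a` of a covector. -/
noncomputable def covectorSpinor (f : TangentSpace (𝓡 4) x →ₗ[ℝ] ℂ) (A A' : Fin 2) : ℂ :=
  ∑ i, (sgn i : ℂ) * P.sigLow x (g.frame x i) A A' * f (g.frame x i)

/-- A covector is recovered from its spinor components: `f(u) = u^{AA'} f_{AA'}`. -/
theorem covector_eq (f : TangentSpace (𝓡 4) x →ₗ[ℝ] ℂ) (u : TangentSpace (𝓡 4) x) :
    f u = P.sigLow x u 0 0 * P.covectorSpinor x f 1 1 + P.sigLow x u 1 1 * P.covectorSpinor x f 0 0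
      - P.sigLow x u 0 1 * P.covectorSpinor x f 1 0
      - P.sigLow x u 1 0 * P.covectorSpinor x f 0 1 := by
  conv_lhs => rw [← (g.frame x).sum_repr u]
  simp only [map_sum, map_smul, g.repr_frame x u, Complex.real_smul, Complex.ofReal_mul, P.val_eq]
  simp only [covectorSpinor, Fin.sum_univ_four]
  ring

/-- The trace of an endomorphism of the tangent space, in terms of the components `c` of its
complex linear extension. -/
theorem sum_repr_eq_trace (L : TangentSpace (𝓡 4) x → TangentSpace (𝓡 4) x)
    (c : Fin 2 → Fin 2 → Fin 2 → Fin 2 → ℂ)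
    (hL : ∀ i A B, P.sigLow x (L (g.frame x i)) A B
      = ∑ C, ∑ D, P.sigLow x (g.frame x i) C D * c C D A B) :
    ((∑ i, (g.frame x).repr (L (g.frame x i)) i : ℝ) : ℂ)
      = ∑ A, ∑ B, c A B A B := by
  have h := P.sigLow_complete x
  simp only [Complex.ofReal_sum, g.repr_frame, Complex.ofReal_mul, P.val_eq, hL]
  simp only [Fin.sum_univ_two, Fin.sum_univ_four] at h ⊢
  have e01 : epsUp 0 1 = 1 := by simp [epsUp]
  have e10 : epsUp 1 0 = -1 := by simp [epsUp]
  have e00 : epsUp 0 0 = 0 := by simp [epsUp]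
  have e11 : epsUp 1 1 = 0 := by simp [epsUp]
  have hh := fun C D : Fin 2 => (⟨h C D 0 0, h C D 0 1, h C D 1 0, h C D 1 1⟩ : _ ∧ _ ∧ _ ∧ _)
  obtain ⟨a1, a2, a3, a4⟩ := hh 0 0
  obtain ⟨b1, b2, b3, b4⟩ := hh 0 1
  obtain ⟨c1, c2, c3, c4⟩ := hh 1 0
  obtain ⟨d1, d2, d3, d4⟩ := hh 1 1
  simp only [e00, e01, e10, e11] at *
  linear_combination c 0 0 0 0 * a4 + c 0 0 1 1 * a1 - c 0 0 0 1 * a3 - c 0 0 1 0 * a2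
    + c 0 1 0 0 * b4 + c 0 1 1 1 * b1 - c 0 1 0 1 * b3 - c 0 1 1 0 * b2
    + c 1 0 0 0 * c4 + c 1 0 1 1 * c1 - c 1 0 0 1 * c3 - c 1 0 1 0 * c2
    + c 1 1 0 0 * d4 + c 1 1 1 1 * d1 - c 1 1 0 1 * d3 - c 1 1 1 0 * d2

/-- The metric trace of a bilinear form given in spinor components. -/
theorem sum_sgn_bilinear (c : Fin 2 → Fin 2 → Fin 2 → Fin 2 → ℂ) :
    ∑ i, (sgn i : ℂ) * ∑ A, ∑ A', ∑ B, ∑ B',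
        P.sigLow x (g.frame x i) A A' * P.sigLow x (g.frame x i) B B' * c A A' B B'
      = c 0 0 1 1 + c 1 1 0 0 - c 0 1 1 0 - c 1 0 0 1 := by
  have h : ∑ i, (sgn i : ℂ) * ∑ A, ∑ A', ∑ B, ∑ B',
        P.sigLow x (g.frame x i) A A' * P.sigLow x (g.frame x i) B B' * c A A' B B'
      = ∑ A, ∑ A', ∑ B, ∑ B', (∑ i, (sgn i : ℂ) *
        (P.sigLow x (g.frame x i) A A' * P.sigLow x (g.frame x i) B B')) * c A A' B B' := by
    simp only [Fin.sum_univ_two, Fin.sum_univ_four]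
    ring
  rw [h]
  simp only [P.sigLow_complete, Fin.sum_univ_two, epsUp]
  simp
  ring

/-- Contraction of the last index of the volume form with a covector `c^{AA'} v^a σ_{aAA'}`. -/
theorem sum_volumeForm_mul (u v w : TangentSpace (𝓡 4) x) (c : Fin 2 → Fin 2 → ℂ) :
    ∑ f, (sgn f : ℂ) * P.volumeForm x u v w (g.frame x f) *
        (∑ A, ∑ B, P.sigLow x (g.frame x f) A B * c A B)
      = -(Complex.I * Matrix.det
        !![P.sigLow x u 0 0, P.sigLow x u 0 1, P.sigLow x u 1 0, P.sigLow x u 1 1;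
           P.sigLow x v 0 0, P.sigLow x v 0 1, P.sigLow x v 1 0, P.sigLow x v 1 1;
           P.sigLow x w 0 0, P.sigLow x w 0 1, P.sigLow x w 1 0, P.sigLow x w 1 1;
           c 1 1, -c 1 0, -c 0 1, c 0 0]) := by
  -- the minors of the first three rows, as determinants with a unit vector in the last row
  set m : Fin 2 → Fin 2 → ℂ := fun A B => -(Complex.I * Matrix.det
      !![P.sigLow x u 0 0, P.sigLow x u 0 1, P.sigLow x u 1 0, P.sigLow x u 1 1;
         P.sigLow x v 0 0, P.sigLow x v 0 1, P.sigLow x v 1 0, P.sigLow x v 1 1;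
         P.sigLow x w 0 0, P.sigLow x w 0 1, P.sigLow x w 1 0, P.sigLow x w 1 1;
         if A = 0 ∧ B = 0 then 1 else 0, if A = 0 ∧ B = 1 then 1 else 0,
         if A = 1 ∧ B = 0 then 1 else 0, if A = 1 ∧ B = 1 then 1 else 0]) with hm
  have hη : ∀ z, P.volumeForm x u v w z = ∑ A, ∑ B, P.sigLow x z A B * m A B := by
    intro z
    have h := P.volumeForm_eq_det x ![u, v, w, z]
    simp only [Matrix.cons_val] at h
    rw [h]
    simp [hm, Matrix.det_succ_row_zero, Fin.sum_univ_succ, Fin.succAbove]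
    ring
  have h := P.sum_sgn_bilinear x (fun A A' B B' => m A A' * c B B')
  calc _ = ∑ i, (sgn i : ℂ) * ∑ A, ∑ A', ∑ B, ∑ B',
        P.sigLow x (g.frame x i) A A' * P.sigLow x (g.frame x i) B B' * (m A A' * c B B') := by
        refine Finset.sum_congr rfl fun i _ => ?_
        rw [hη]
        simp only [Fin.sum_univ_two]
        ring
    _ = _ := by
        rw [h]
        simp [hm, Matrix.det_succ_row_zero, Fin.sum_univ_succ, Fin.succAbove]
        ring

/-- Raising both indices of a `2 × 2` matrix gives its matrix of cofactors. -/
theorem sigUp_eq (v : TangentSpace (𝓡 4) x) :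
    P.sigUp x v = ![![P.sigLow x v 1 1, -P.sigLow x v 1 0],
      ![-P.sigLow x v 0 1, P.sigLow x v 0 0]] := by
  funext A B
  fin_cases A <;> fin_cases B <;> simp [sigUp, Fin.sum_univ_two, epsUp]

/-- `α^A = ε^{AB} α_B`. -/
theorem spinor_eq (α : S x) :
    α = P.low x α 1 • P.spinFrame x 0 - P.low x α 0 • P.spinFrame x 1 := by
  have h := (P.spinFrame x).sum_repr α
  rw [Fin.sum_univ_two] at h
  have h0 : P.low x α 0 = -(P.spinFrame x).repr α 1 := by
    simp only [low]
    conv_lhs => rw [← h]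
    simp [P.ε_spinFrame, epsUp]
  have h1 : P.low x α 1 = (P.spinFrame x).repr α 0 := by
    simp only [low]
    conv_lhs => rw [← h]
    simp [P.ε_spinFrame, epsUp]
  rw [h0, h1]
  conv_lhs => rw [← h]
  module

/-- `σ(v, α, β) = v_{AA'} α^A \bar β^{A'}`, with the upper components written by the lower ones. -/
theorem σ_eq (v : TangentSpace (𝓡 4) x) (α β : S x) :
    P.σ x v α β = P.sigLow x v 0 0 * (P.low x α 1 * conj (P.low x β 1))
      + P.sigLow x v 1 1 * (P.low x α 0 * conj (P.low x β 0))
      - P.sigLow x v 0 1 * (P.low x α 1 * conj (P.low x β 0))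
      - P.sigLow x v 1 0 * (P.low x α 0 * conj (P.low x β 1)) := by
  conv_lhs => rw [P.spinor_eq x α, P.spinor_eq x β]
  simp only [map_sub, map_smul, LinearMap.sub_apply, LinearMap.smul_apply, smul_eq_mul,
    LinearMap.map_smulₛₗ, sigLow]
  ring

end SpinStructure
end Components
/-! ### The Nester–Witten form and the tensor `Z` in components -/

section NesterWitten

variable {M : Type*} [TopologicalSpace M] [ChartedSpace E4 M] [IsManifold (𝓡 4) ∞ M]
  {g : LorentzMetric M}
  {V : Type*} [NormedAddCommGroup V] [NormedSpace ℂ V]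
  {S : M → Type*} [TopologicalSpace (TotalSpace V S)]
  [∀ x, AddCommGroup (S x)] [∀ x, Module ℂ (S x)] [∀ x, TopologicalSpace (S x)]
  [FiberBundle V S]
  [∀ x, IsTopologicalAddGroup (S x)] [∀ x, ContinuousSMul ℝ (S x)]

namespace SpinStructure

variable (P : SpinStructure g V S) (nS : CovariantDerivative (𝓡 4) V S) (lam : ∀ y, S y) (x : M)

/-- The covector `v ↦ v^b ∇_b λ_A`. -/
noncomputable def covDerivLow (A : Fin 2) : TangentSpace (𝓡 4) x →ₗ[ℝ] ℂ where
  toFun v := P.low x (nS lam x v) A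
  map_add' u v := by simp [low]
  map_smul' c v := by
    simp only [low, map_smul, RingHom.id_apply]
    rw [← Complex.coe_smul, map_smul, LinearMap.smul_apply, Complex.coe_smul]

theorem low_covDeriv (v : TangentSpace (𝓡 4) x) (A : Fin 2) :
    P.low x (nS lam x v) A = P.sigLow x v 0 0 * P.nabla nS lam x 1 1 A
      + P.sigLow x v 1 1 * P.nabla nS lam x 0 0 A - P.sigLow x v 0 1 * P.nabla nS lam x 1 0 A
      - P.sigLow x v 1 0 * P.nabla nS lam x 0 1 A :=
  P.covector_eq x (P.covDerivLow nS lam x A) v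

theorem conj_nabla (B B' A : Fin 2) :
    conj (P.nabla nS lam x B B' A) = P.nablaConj nS lam x B' B A := by
  simp only [nabla, nablaConj, map_sum, map_mul, P.sigLow_conj, Complex.conj_ofReal]

/-- The frame-free form of the Nester–Witten form. -/
theorem nesterWittenForm_eq (u v : TangentSpace (𝓡 4) x) :
    P.nesterWittenForm nS lam x u v
      = Complex.I / 2 * (P.σ x u (nS lam x v) (lam x) - P.σ x v (nS lam x u) (lam x)) := by
  rw [P.σ_eq, P.σ_eq]
  simp only [P.low_covDeriv nS lam x]
  simp only [nesterWittenForm, nesterWitten, P.sigUp_eq, Fin.sum_univ_two, Matrix.cons_val_zero,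
    Matrix.cons_val_one]
  ring

/-- The components, with lower indices, of the covector `Z_d{}^{[d}{}_{f]}`. -/
noncomputable def sparlingZTraceSpinor (C C' : Fin 2) : ℂ :=
  1 / 2 * ∑ A, ∑ A', ∑ B, ∑ B', epsUp A B * epsUp A' B' *
    (P.nabla nS lam x B C' A * P.nablaConj nS lam x C B' A'
      - P.nabla nS lam x C B' A * P.nablaConj nS lam x B C' A')

theorem sparlingZTrace_eq (w : TangentSpace (𝓡 4) x) :
    P.sparlingZTrace nS lam x w
      = ∑ C, ∑ C', P.sigUp x w C C' * P.sparlingZTraceSpinor nS lam x C C' := by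
  have up : ∀ A A' B B', ∑ i, (sgn i : ℂ) * (P.sigUp x (g.frame x i) A A'
      * P.sigUp x (g.frame x i) B B') = epsUp A B * epsUp A' B' := by
    intro A A' B B'
    have h := P.sigLow_complete x (1 - A) (1 - A') (1 - B) (1 - B')
    fin_cases A <;> fin_cases A' <;> fin_cases B <;> fin_cases B' <;>
      simpa [P.sigUp_eq, epsUp] using h
  calc P.sparlingZTrace nS lam x w
      = ∑ A, ∑ A', ∑ B, ∑ B', (∑ i, (sgn i : ℂ) * (P.sigUp x (g.frame x i) A A'
          * P.sigUp x (g.frame x i) B B')) * (1 / 2 * ∑ C, ∑ C', P.sigUp x w C C' *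
            (P.nabla nS lam x B C' A * P.nablaConj nS lam x C B' A'
              - P.nabla nS lam x C B' A * P.nablaConj nS lam x B C' A')) := by
        have h : ∀ i, (sgn i : ℂ) * (1 / 2 *
            (P.sparlingZ nS lam x (g.frame x i) (g.frame x i) w
              - P.sparlingZ nS lam x (g.frame x i) w (g.frame x i)))
            = ∑ A, ∑ A', ∑ B, ∑ B', ((sgn i : ℂ) * (P.sigUp x (g.frame x i) A A'
              * P.sigUp x (g.frame x i) B B')) * (1 / 2 * ∑ C, ∑ C', P.sigUp x w C C' *
                (P.nabla nS lam x B C' A * P.nablaConj nS lam x C B' A'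
                  - P.nabla nS lam x C B' A * P.nablaConj nS lam x B C' A')) := by
          intro i
          simp only [sparlingZ, Fin.sum_univ_two]
          ring
        simp only [sparlingZTrace, h]
        simp only [Finset.sum_mul]
        rw [Finset.sum_comm]
        refine Finset.sum_congr rfl fun A _ => ?_
        rw [Finset.sum_comm]
        refine Finset.sum_congr rfl fun A' _ => ?_
        rw [Finset.sum_comm]
        refine Finset.sum_congr rfl fun B _ => ?_
        rw [Finset.sum_comm]
    _ = _ := by
        simp only [up, sparlingZTraceSpinor, Fin.sum_univ_two]
        ring

/-- The quadratic part of the Sparling identity. -/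
theorem sum_volumeForm_mul_sparlingZTrace (u v w : TangentSpace (𝓡 4) x) :
    ∑ f, (sgn f : ℂ) * P.volumeForm x u v w (g.frame x f) *
        P.sparlingZTrace nS lam x (g.frame x f)
      = Complex.I / 2 *
        (P.σ x v (nS lam x w) (nS lam x u) - P.σ x w (nS lam x v) (nS lam x u)
          + (P.σ x w (nS lam x u) (nS lam x v) - P.σ x u (nS lam x w) (nS lam x v))
          + (P.σ x u (nS lam x v) (nS lam x w) - P.σ x v (nS lam x u) (nS lam x w))) := by
  have hT : ∀ z, P.sparlingZTrace nS lam x z = ∑ A, ∑ B, P.sigLow x z A B *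
      (![![P.sparlingZTraceSpinor nS lam x 1 1, -P.sparlingZTraceSpinor nS lam x 1 0],
        ![-P.sparlingZTraceSpinor nS lam x 0 1, P.sparlingZTraceSpinor nS lam x 0 0]] :
          Fin 2 → Fin 2 → ℂ) A B := by
    intro z
    rw [P.sparlingZTrace_eq]
    simp only [P.sigUp_eq, Fin.sum_univ_two, Matrix.cons_val_zero, Matrix.cons_val_one]
    ring
  simp only [hT]
  rw [P.sum_volumeForm_mul]
  simp only [P.σ_eq, P.low_covDeriv nS lam x, map_sub, map_add, map_mul, P.conj_nabla,
    P.sigLow_conj, sparlingZTraceSpinor]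
  generalize P.nabla nS lam x = n
  generalize P.nablaConj nS lam x = n'
  generalize P.sigLow x u = u'
  generalize P.sigLow x v = v'
  generalize P.sigLow x w = w'
  simp [Matrix.det_succ_row_zero, Fin.sum_univ_succ, Fin.succAbove, epsUp]
  ring

end SpinStructure
end NesterWitten
/-! ### The Einstein tensor of a spin curvature -/

section EinsteinAlgebra

/-- The alternating bilinear form with coefficients `k`, on complexified tangent vectors written as
`2 × 2` matrices. -/
def bivec (k : Fin 6 → ℂ) (U V : Fin 2 → Fin 2 → ℂ) : ℂ :=
  k 0 * (U 0 0 * V 0 1 - U 0 1 * V 0 0) + k 1 * (U 0 0 * V 1 0 - U 1 0 * V 0 0)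
    + k 2 * (U 0 0 * V 1 1 - U 1 1 * V 0 0) + k 3 * (U 0 1 * V 1 0 - U 1 0 * V 0 1)
    + k 4 * (U 0 1 * V 1 1 - U 1 1 * V 0 1) + k 5 * (U 1 0 * V 1 1 - U 1 1 * V 1 0)

/-- The coefficients of the complex conjugate of `bivec k`. -/
def bivecConj (k : Fin 6 → ℂ) : Fin 6 → ℂ :=
  ![conj (k 1), conj (k 0), conj (k 2), -conj (k 3), conj (k 5), conj (k 4)]

theorem conj_bivec (k : Fin 6 → ℂ) {U V : Fin 2 → Fin 2 → ℂ}
    (hU : ∀ A B, conj (U A B) = U B A) (hV : ∀ A B, conj (V A B) = V B A) :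
    conj (bivec k U V) = bivec (bivecConj k) U V := by
  simp only [bivec, bivecConj, map_add, map_sub, map_mul, hU, hV, Matrix.cons_val]
  ring

/-- The matrix `r_A{}^C` of a trace free spin curvature with coefficients `a`, `b`, `c`. -/
def spinMatrix (a b c : Fin 6 → ℂ) (U V : Fin 2 → Fin 2 → ℂ) : Fin 2 → Fin 2 → ℂ :=
  ![![bivec a U V, bivec b U V], ![bivec c U V, -bivec a U V]]

/-- The curvature `R(U,V)W` of the tangent bundle induced by spin curvature matrices `r` on `S` and
`r'` on the conjugate bundle. -/
def inducedCurvature (r r' : Fin 2 → Fin 2 → ℂ) (W : Fin 2 → Fin 2 → ℂ) (A B : Fin 2) : ℂ :=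
  -(∑ C, r A C * W C B + ∑ C, W A C * r' B C)

/-- The matrix units. -/
def unitMatrix (A B : Fin 2) : Fin 2 → Fin 2 → ℂ := fun C D => if A = C ∧ B = D then 1 else 0

/-- The Ricci form of the induced curvature: `a`, `b`, `c` are the coefficients of the curvature of
`S`, and `a'`, `b'`, `c'` those of the conjugate bundle. -/
def ricciForm (a b c a' b' c' : Fin 6 → ℂ) (V W : Fin 2 → Fin 2 → ℂ) : ℂ :=
  ∑ A, ∑ B, inducedCurvature (spinMatrix a b c (unitMatrix A B) V)
    (spinMatrix a' b' c' (unitMatrix A B) V) W A B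

/-- The metric on complexified tangent vectors: the polarized determinant. -/
def metricForm (V W : Fin 2 → Fin 2 → ℂ) : ℂ :=
  V 0 0 * W 1 1 + V 1 1 * W 0 0 - V 0 1 * W 1 0 - V 1 0 * W 0 1

/-- The metric trace of a bilinear form on complexified tangent vectors. -/
def metricTrace (Q : (Fin 2 → Fin 2 → ℂ) → (Fin 2 → Fin 2 → ℂ) → ℂ) : ℂ :=
  Q (unitMatrix 0 0) (unitMatrix 1 1) + Q (unitMatrix 1 1) (unitMatrix 0 0)
    - Q (unitMatrix 0 1) (unitMatrix 1 0) - Q (unitMatrix 1 0) (unitMatrix 0 1)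

/-- The Einstein form of the induced curvature. -/
noncomputable def einsteinForm (a b c a' b' c' : Fin 6 → ℂ) (V W : Fin 2 → Fin 2 → ℂ) : ℂ :=
  ricciForm a b c a' b' c' V W
    - 1 / 2 * metricTrace (ricciForm a b c a' b' c') * metricForm V W

theorem ricciForm_eq (a b c a' b' c' : Fin 6 → ℂ) (V W : Fin 2 → Fin 2 → ℂ) :
    ricciForm a b c a' b' c' V W = ∑ C, ∑ D, ∑ E, ∑ F, V C D * W E F *
      ricciForm a b c a' b' c' (unitMatrix C D) (unitMatrix E F) := by
  simp [ricciForm, inducedCurvature, spinMatrix, bivec, unitMatrix, Fin.sum_univ_two]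
  ring

theorem einsteinForm_eq (a b c a' b' c' : Fin 6 → ℂ) (V W : Fin 2 → Fin 2 → ℂ) :
    einsteinForm a b c a' b' c' V W = ∑ C, ∑ D, W C D *
      einsteinForm a b c a' b' c' V (unitMatrix C D) := by
  simp only [einsteinForm]
  generalize metricTrace (ricciForm a b c a' b' c') = t
  simp [ricciForm, inducedCurvature, spinMatrix, bivec, unitMatrix, metricForm, Fin.sum_univ_two]
  ring

/-- The algebraic form of the curvature part of the Sparling identity. The left-hand side is
`-(i/2)` times the cyclic sum of `σ(W, R(U,V)λ, λ)`, where `λ` has lower components `l` and upper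
components `![l 1, -l 0]`. On the right, the determinant is the contraction of the volume form with
`G(ξ, ·)`, and the last term is the cyclic sum that the first Bianchi identity annihilates. -/
theorem det_einsteinForm (a b c a' b' c' : Fin 6 → ℂ) (U V W : Fin 2 → Fin 2 → ℂ)
    (l l' : Fin 2 → ℂ) {r r' : (Fin 2 → Fin 2 → ℂ) → (Fin 2 → Fin 2 → ℂ) → Fin 2 → Fin 2 → ℂ}
    (hr : r = spinMatrix a b c) (hr' : r' = spinMatrix a' b' c') {G : Fin 2 → Fin 2 → ℂ}
    (hG : ∀ A B, G A B
      = einsteinForm a b c a' b' c' (fun A B => l A * l' B) (unitMatrix A B)) :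
    -(Complex.I / 2) * ∑ A, ∑ B, ![l 1, -l 0] A * ![l' 1, -l' 0] B *
        ∑ C, (r U V A C * W C B + r V W A C * U C B + r W U A C * V C B)
      = 1 / 4 * (Complex.I * Matrix.det
        !![U 0 0, U 0 1, U 1 0, U 1 1; V 0 0, V 0 1, V 1 0, V 1 1; W 0 0, W 0 1, W 1 0, W 1 1;
           G 1 1, -G 1 0, -G 0 1, G 0 0])
        + Complex.I / 4 * ∑ A, ∑ B, ![l 1, -l 0] A * ![l' 1, -l' 0] B *
          (inducedCurvature (r U V) (r' U V) W A B + inducedCurvature (r V W) (r' V W) U A B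
            + inducedCurvature (r W U) (r' W U) V A B) := by
  subst hr hr'
  simp only [hG]
  simp [einsteinForm, metricTrace, ricciForm, inducedCurvature, spinMatrix, bivec, unitMatrix,
    metricForm, Matrix.det_succ_row_zero, Fin.sum_univ_succ, Fin.succAbove]
  ring

end EinsteinAlgebra
/-! ### The curvature tensors at a point -/

section Extend

variable {M : Type*} [TopologicalSpace M]
  {F : Type*} [NormedAddCommGroup F] [NormedSpace ℝ F]
  {W : M → Type*} [TopologicalSpace (TotalSpace F W)]
  [∀ x, AddCommGroup (W x)] [∀ x, Module ℝ (W x)] [∀ x, TopologicalSpace (W x)]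
  [FiberBundle F W] [VectorBundle ℝ F W]

theorem smoothOn_extend [ChartedSpace E4 M] [IsManifold (𝓡 4) ∞ M]
    [ContMDiffVectorBundle ∞ F W (𝓡 4)] {x : M} (w : W x) :
    SmoothOn F (trivializationAt F W x).baseSet (FiberBundle.extend F w) := by
  set t := trivializationAt F W x
  intro y hy
  -- in the trivialization at `x`, the extension is constant
  rw [t.contMDiffWithinAt_section _ hy]
  exact (contMDiffOn_const (c := (t ⟨x, w⟩).2)).congr
    (fun z hz => by simp [FiberBundle.extend, t, hz]) y hy

theorem extend_eq_linear {x y : M} (hy : y ∈ (trivializationAt F W x).baseSet) (w : W x) :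
    FiberBundle.extend F w y = (trivializationAt F W x).symmₗ ℝ y
      ((trivializationAt F W x).linearMapAt ℝ x w) := by
  rw [Trivialization.coe_linearMapAt_of_mem _ (FiberBundle.mem_baseSet_trivializationAt F W x),
    Trivialization.coe_symmₗ _ hy]
  rfl

theorem extend_add {x y : M} (hy : y ∈ (trivializationAt F W x).baseSet) (v w : W x) :
    FiberBundle.extend F (v + w) y = FiberBundle.extend F v y + FiberBundle.extend F w y := by
  simp only [extend_eq_linear hy, map_add]

theorem extend_smul {x y : M} (hy : y ∈ (trivializationAt F W x).baseSet) (c : ℝ) (w : W x) :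
    FiberBundle.extend F (c • w) y = c • FiberBundle.extend F w y := by
  simp only [extend_eq_linear hy, map_smul]

end Extend

section Curvature

variable {M : Type*} [TopologicalSpace M] [ChartedSpace E4 M] [IsManifold (𝓡 4) ∞ M]
  {g : LorentzMetric M}
  {V : Type*} [NormedAddCommGroup V] [NormedSpace ℂ V]
  {S : M → Type*} [TopologicalSpace (TotalSpace V S)]
  [∀ x, AddCommGroup (S x)] [∀ x, Module ℂ (S x)] [∀ x, TopologicalSpace (S x)]
  [FiberBundle V S]

namespace SpinStructure

variable (P : SpinStructure g V S) (x : M)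

/-- Every complex valued alternating bilinear form on the tangent space has the form `bivec k` in
spinor components. -/
theorem exists_bivec (B : TangentSpace (𝓡 4) x → TangentSpace (𝓡 4) x → ℂ)
    (hadd : ∀ u u' v, B (u + u') v = B u v + B u' v)
    (hsmul : ∀ (c : ℝ) u v, B (c • u) v = c * B u v) (hswap : ∀ u v, B v u = -B u v) :
    ∃ k : Fin 6 → ℂ, ∀ u v, B u v = bivec k (P.sigLow x u) (P.sigLow x v) := by
  obtain ⟨K, lin⟩ : ∃ K : Fin 4 → Fin 2 → Fin 2 → ℂ, ∀ f : TangentSpace (𝓡 4) x → ℂ,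
      (∀ u v, f (u + v) = f u + f v) → (∀ (c : ℝ) u, f (c • u) = c * f u) → ∀ u,
      f u = ∑ A, ∑ A', P.sigLow x u A A' * ∑ i, K i A A' * f (g.frame x i) := by
    refine ⟨fun i => ![![sgn i * P.sigLow x (g.frame x i) 1 1,
      -(sgn i * P.sigLow x (g.frame x i) 1 0)], ![-(sgn i * P.sigLow x (g.frame x i) 0 1),
      sgn i * P.sigLow x (g.frame x i) 0 0]], fun f ha hs u => ?_⟩
    have h := P.covector_eq x ⟨⟨f, ha⟩, fun c u => by simpa using hs c u⟩ u
    change f u = _ at h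
    rw [h]
    simp only [covectorSpinor, LinearMap.coe_mk, AddHom.coe_mk, Fin.sum_univ_two, Fin.sum_univ_four,
      Matrix.cons_val_zero, Matrix.cons_val_one]
    ring
  have hadd' : ∀ u v v', B u (v + v') = B u v + B u v' := fun u v v' => by
    rw [hswap, hadd, hswap u v, hswap u v']; ring
  have hsmul' : ∀ (c : ℝ) u v, B u (c • v) = c * B u v := fun c u v => by
    rw [hswap, hsmul, hswap u v]; ring
  obtain ⟨C, hC⟩ : ∃ C : Fin 2 → Fin 2 → Fin 2 → Fin 2 → ℂ, ∀ u v, B u v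
      = ∑ A, ∑ A', ∑ D, ∑ D', P.sigLow x u A A' * P.sigLow x v D D' * C A A' D D' := by
    obtain ⟨T, hT⟩ : ∃ T : Fin 4 → Fin 2 → Fin 2 → ℂ, ∀ i v, B (g.frame x i) v
        = ∑ D, ∑ D', P.sigLow x v D D' * T i D D' :=
      ⟨_, fun i v => lin (fun v => B (g.frame x i) v) (hadd' _) (fun c v => hsmul' c _ v) v⟩
    refine ⟨fun A A' D D' => ∑ i, K i A A' * T i D D', fun u v => ?_⟩
    rw [lin (fun u => B u v) (fun u u' => hadd u u' v) (fun c u => hsmul c u v) u]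
    simp only [hT, Fin.sum_univ_two, Fin.sum_univ_four]
    ring
  refine ⟨![(C 0 0 0 1 - C 0 1 0 0) / 2, (C 0 0 1 0 - C 1 0 0 0) / 2, (C 0 0 1 1 - C 1 1 0 0) / 2,
    (C 0 1 1 0 - C 1 0 0 1) / 2, (C 0 1 1 1 - C 1 1 0 1) / 2, (C 1 0 1 1 - C 1 1 1 0) / 2],
    fun u v => ?_⟩
  have h : B u v = (B u v - B v u) / 2 := by rw [hswap u v]; ring
  rw [h, hC, hC]
  simp only [bivec, Fin.sum_univ_two, Matrix.cons_val]
  ring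

/-- The components of the vector representing `κ^A \bar κ^{A'}` are `κ_A \bar κ_{A'}`. -/
theorem sigLow_toVector (κ : S x) (A B : Fin 2) :
    P.sigLow x (P.toVector x κ) A B = P.low x κ A * conj (P.low x κ B) := by
  have hre : ∀ i, (((P.σ x (g.frame x i) κ κ).re : ℝ) : ℂ) = P.σ x (g.frame x i) κ κ := fun i =>
    Complex.conj_eq_iff_re.1 (P.σ_hermitian x (g.frame x i) κ κ).symm
  have h := P.sigLow_complete x
  simp only [toVector, P.sigLow_sum, Complex.ofReal_mul, hre]
  simp only [P.σ_eq]
  simp only [Fin.sum_univ_four] at h ⊢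
  have h1 := h 0 0 A B
  have h2 := h 1 1 A B
  have h3 := h 0 1 A B
  have h4 := h 1 0 A B
  have e : ∀ A B, epsUp A B = (![![0, 1], ![-1, 0]] : Fin 2 → Fin 2 → ℂ) A B := fun _ _ => rfl
  generalize P.low x κ = l
  have main : ∀ r : ℂ, r = epsUp A 0 * epsUp B 0 * (l 1 * conj (l 1))
      + epsUp A 1 * epsUp B 1 * (l 0 * conj (l 0)) - epsUp A 0 * epsUp B 1 * (l 1 * conj (l 0))
      - epsUp A 1 * epsUp B 0 * (l 0 * conj (l 1)) → r = l A * conj (l B) := by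
    rintro r rfl
    fin_cases A <;> fin_cases B <;> simp [e]
  apply main
  linear_combination (l 1 * conj (l 1)) * h1 + (l 0 * conj (l 0)) * h2
    - (l 1 * conj (l 0)) * h3 - (l 0 * conj (l 1)) * h4

/-- If the curvature of the tangent bundle is induced by spin curvature matrices, then so are the
Ricci and Einstein tensors. -/
theorem einstein_eq_einsteinForm
    (nT : CovariantDerivative (𝓡 4) E4 (TangentSpace (𝓡 4) : M → Type _))
    (a b c a' b' c' : Fin 6 → ℂ)
    (hR : ∀ u v w A B, P.sigLow x (riemann nT x u v w) A B
      = inducedCurvature (spinMatrix a b c (P.sigLow x u) (P.sigLow x v))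
        (spinMatrix a' b' c' (P.sigLow x u) (P.sigLow x v)) (P.sigLow x w) A B)
    (v w : TangentSpace (𝓡 4) x) :
    (einstein g nT x v w : ℂ) = einsteinForm a b c a' b' c' (P.sigLow x v) (P.sigLow x w) := by
  have hric : ∀ v w, (ricci g nT x v w : ℂ)
      = ricciForm a b c a' b' c' (P.sigLow x v) (P.sigLow x w) := by
    intro v w
    refine P.sum_repr_eq_trace x (fun u => riemann nT x u v w) _ fun i A B => ?_
    rw [hR]
    generalize P.sigLow x v = V'
    generalize P.sigLow x w = W'
    fin_cases A <;> fin_cases B <;>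
      simp [inducedCurvature, spinMatrix, bivec, unitMatrix, Fin.sum_univ_two] <;> ring
  have hscal : (scalarCurvature g nT x : ℂ) = metricTrace (ricciForm a b c a' b' c') := by
    simp only [scalarCurvature, Complex.ofReal_sum, Complex.ofReal_mul, hric]
    simp only [fun i => ricciForm_eq a b c a' b' c' (P.sigLow x (g.frame x i))
      (P.sigLow x (g.frame x i))]
    exact P.sum_sgn_bilinear x (fun A A' B B' =>
      ricciForm a b c a' b' c' (unitMatrix A A') (unitMatrix B B'))
  simp only [einstein, Complex.ofReal_sub, Complex.ofReal_mul, hric, hscal, P.val_eq, einsteinForm,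
    metricForm]
  push_cast
  ring

end SpinStructure
end Curvature
/-! ### The curvature part of the identity -/

section ExtendSet

variable {M : Type*} [TopologicalSpace M] [ChartedSpace E4 M] [IsManifold (𝓡 4) ∞ M]
  {V : Type*} [NormedAddCommGroup V]
  {S : M → Type*} [TopologicalSpace (TotalSpace V S)] [∀ x, TopologicalSpace (S x)]
  [FiberBundle V S]

/-- A neighbourhood of `x` on which the local extensions of vectors and spinors at `x` are
smooth. -/
def extendSet (V : Type*) [NormedAddCommGroup V] (S : M → Type*)
    [TopologicalSpace (TotalSpace V S)] [∀ x, TopologicalSpace (S x)] [FiberBundle V S] (x : M) :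
    Set M :=
  (trivializationAt E4 (TangentSpace (𝓡 4) : M → Type _) x).baseSet
    ∩ (trivializationAt V S x).baseSet

theorem isOpen_extendSet (x : M) : IsOpen (extendSet V S x) :=
  (Trivialization.open_baseSet _).inter (Trivialization.open_baseSet _)

theorem mem_extendSet (x : M) : x ∈ extendSet V S x :=
  ⟨FiberBundle.mem_baseSet_trivializationAt _ _ x, FiberBundle.mem_baseSet_trivializationAt _ _ x⟩

theorem smoothOn_extend_tangent {x : M} (u : TangentSpace (𝓡 4) x) :
    SmoothOn E4 (extendSet V S x) (FiberBundle.extend E4 u) :=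
  (smoothOn_extend u).mono Set.inter_subset_left

theorem smoothOn_extend_spin [NormedSpace ℂ V] [∀ x, AddCommGroup (S x)] [∀ x, Module ℂ (S x)]
    [VectorBundle ℝ V S] [ContMDiffVectorBundle ∞ V S (𝓡 4)] {x : M} (α : S x) :
    SmoothOn V (extendSet V S x) (FiberBundle.extend V α) :=
  (smoothOn_extend α).mono Set.inter_subset_right

end ExtendSet

section CurvaturePart

variable {M : Type*} [TopologicalSpace M] [T2Space M] [ChartedSpace E4 M]
  [IsManifold (𝓡 4) ∞ M] {g : LorentzMetric M}
  {V : Type*} [NormedAddCommGroup V] [NormedSpace ℂ V]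
  {S : M → Type*} [TopologicalSpace (TotalSpace V S)]
  [∀ x, AddCommGroup (S x)] [∀ x, Module ℂ (S x)] [∀ x, TopologicalSpace (S x)]
  [∀ x, IsTopologicalAddGroup (S x)] [∀ x, ContinuousSMul ℝ (S x)]
  [FiberBundle V S] [VectorBundle ℝ V S] [ContMDiffVectorBundle ∞ V S (𝓡 4)]
  {P : SpinStructure g V S}
  {nT : CovariantDerivative (𝓡 4) E4 (TangentSpace (𝓡 4) : M → Type _)}
  {nS : CovariantDerivative (𝓡 4) V S}

/-- The curvature of the spin bundle at a point is given by trace free matrices, whose entries are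
alternating in the components of the two vectors. -/
theorem IsSpinCovariantDerivative.exists_spinMatrix (hn : IsSpinCovariantDerivative P nT nS)
    (x : M) : ∃ a b c : Fin 6 → ℂ, ∀ (u v : TangentSpace (𝓡 4) x) (A : Fin 2),
      bundleCurvature nS (FiberBundle.extend E4 u) (FiberBundle.extend E4 v)
          (FiberBundle.extend V (P.spinFrame x A)) x
        = ∑ C, spinMatrix a b c (P.sigLow x u) (P.sigLow x v) A C • P.spinFrame x C := by
  set R : TangentSpace (𝓡 4) x → TangentSpace (𝓡 4) x → Fin 2 → S x := fun u v A =>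
    bundleCurvature nS (FiberBundle.extend E4 u) (FiberBundle.extend E4 v)
      (FiberBundle.extend V (P.spinFrame x A)) x with hRdef
  have hU := isOpen_extendSet (V := V) (S := S) x
  have hx := mem_extendSet (V := V) (S := S) x
  have hadd : ∀ u u' v A, R (u + u') v A = R u v A + R u' v A := fun u u' v A => by
    refine (bundleCurvature_congr_left hn.smooth_spin hU hx (smoothOn_extend_tangent (u + u'))
      ((smoothOn_extend_tangent u).add_section (smoothOn_extend_tangent u'))
      (smoothOn_extend_spin _) fun y hy => extend_add hy.1 u u').trans ?_
    exact bundleCurvature_add_left hn.smooth_spin hU hx (smoothOn_extend_tangent u)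
      (smoothOn_extend_tangent u') (smoothOn_extend_spin _)
  have hsmul : ∀ (c : ℝ) u v A, R (c • u) v A = (c : ℂ) • R u v A := fun c u v A => by
    simp only [hRdef, Complex.coe_smul]
    refine (bundleCurvature_congr_left hn.smooth_spin hU hx (smoothOn_extend_tangent (c • u))
      (ContMDiffOn.const_smul_section (smoothOn_extend_tangent u))
      (smoothOn_extend_spin _) fun y hy => extend_smul hy.1 c u).trans ?_
    exact bundleCurvature_smul_left hn.smooth_spin hU hx c (smoothOn_extend_tangent u)
      (smoothOn_extend_spin _)
  have hswap : ∀ u v A, R v u A = -R u v A := fun u v A => bundleCurvature_swap nS _ _ _ x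
  have coeff : ∀ A B, ∃ k : Fin 6 → ℂ, ∀ u v,
      P.low x (R u v A) B = bivec k (P.sigLow x u) (P.sigLow x v) := fun A B =>
    P.exists_bivec x (fun u v => P.low x (R u v A) B)
      (fun u u' v => by simp [hadd, SpinStructure.low])
      (fun c u v => by simp only [hsmul, SpinStructure.low, map_smul, LinearMap.smul_apply,
        smul_eq_mul])
      (fun u v => by simp only [hswap u v, SpinStructure.low, map_neg, LinearMap.neg_apply])
  obtain ⟨a, ha⟩ := coeff 0 1
  obtain ⟨b, hb⟩ := coeff 0 0
  obtain ⟨c, hc⟩ := coeff 1 1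
  have htr : ∀ u v, P.low x (R u v 1) 0 = P.low x (R u v 0) 1 := fun u v => by
    have h := hn.ε_curvature hU hx (smoothOn_extend_tangent u) (smoothOn_extend_tangent v)
      (smoothOn_extend_spin (P.spinFrame x 0)) (smoothOn_extend_spin (P.spinFrame x 1))
    simp only [FiberBundle.extend_apply_self] at h
    rw [P.ε_swap x (P.spinFrame x 0)] at h
    exact (add_neg_eq_zero.1 h).symm
  refine ⟨a, fun i => -b i, c, fun u v A => ?_⟩
  have hb' : bivec (fun i => -b i) (P.sigLow x u) (P.sigLow x v) = -P.low x (R u v 0) 0 := by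
    rw [hb]
    simp only [bivec]
    ring
  change R u v A = _
  rw [P.spinor_eq x (R u v A)]
  fin_cases A
  · simp [spinMatrix, hb', ← ha, sub_eq_add_neg]
  · simp [spinMatrix, ← hc, ← ha, htr, sub_eq_add_neg]

theorem conj_spinMatrix (a b c : Fin 6 → ℂ) {U V : Fin 2 → Fin 2 → ℂ}
    (hU : ∀ A B, conj (U A B) = U B A) (hV : ∀ A B, conj (V A B) = V B A) (A B : Fin 2) :
    conj (spinMatrix a b c U V A B)
      = spinMatrix (bivecConj a) (bivecConj b) (bivecConj c) U V A B := by
  fin_cases A <;> fin_cases B <;> simp [spinMatrix, conj_bivec, hU, hV]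

/-- The contraction of the volume form with the covector `G(ξ, ·)` is `2i` times the cyclic sum of
`σ(w, R(u,v)λ, λ)`. -/
theorem IsSpinCovariantDerivative.sum_volumeForm_mul_einstein
    (hn : IsSpinCovariantDerivative P nT nS) {x : M} {lam : ∀ y, S y}
    (hlam : SmoothOn V Set.univ lam) (u v w : TangentSpace (𝓡 4) x) :
    ∑ f, (sgn f : ℂ) * P.volumeForm x u v w (g.frame x f) *
        (einstein g nT x (P.toVector x (lam x)) (g.frame x f) : ℂ)
      = 4 * (Complex.I / 2 *
        (P.σ x w (bundleCurvature nS (FiberBundle.extend E4 u) (FiberBundle.extend E4 v) lam x)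
            (lam x)
          + P.σ x u (bundleCurvature nS (FiberBundle.extend E4 v) (FiberBundle.extend E4 w) lam x)
            (lam x)
          + P.σ x v (bundleCurvature nS (FiberBundle.extend E4 w) (FiberBundle.extend E4 u) lam x)
            (lam x))) := by
  obtain ⟨a, b, c, hr⟩ := hn.exists_spinMatrix x
  have hU := isOpen_extendSet (V := V) (S := S) x
  have hx := mem_extendSet (V := V) (S := S) x
  have hR : ∀ u v w A B, P.sigLow x (riemann nT x u v w) A B
      = inducedCurvature (spinMatrix a b c (P.sigLow x u) (P.sigLow x v))
        (spinMatrix (bivecConj a) (bivecConj b) (bivecConj c) (P.sigLow x u) (P.sigLow x v))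
        (P.sigLow x w) A B := by
    intro u v w A B
    have h := hn.σ_curvature hU hx (smoothOn_extend_tangent u) (smoothOn_extend_tangent v)
      (smoothOn_extend_tangent w) (smoothOn_extend_spin (P.spinFrame x A))
      (smoothOn_extend_spin (P.spinFrame x B))
    simp only [FiberBundle.extend_apply_self, hr] at h
    change P.sigLow x (riemann nT x u v w) A B + _ + _ = 0 at h
    simp only [map_sum, map_smul, LinearMap.sum_apply, LinearMap.smul_apply, smul_eq_mul,
      LinearMap.map_smulₛₗ, conj_spinMatrix a b c (P.sigLow_conj x u) (P.sigLow_conj x v)] at h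
    simp only [inducedCurvature, Fin.sum_univ_two, SpinStructure.sigLow] at h ⊢
    linear_combination h
  have hRlam : ∀ u v B,
      P.low x (bundleCurvature nS (FiberBundle.extend E4 u) (FiberBundle.extend E4 v) lam x) B
        = -∑ C, spinMatrix a b c (P.sigLow x u) (P.sigLow x v) B C * P.low x (lam x) C := by
    intro u v B
    have h := hn.ε_curvature hU hx (smoothOn_extend_tangent u) (smoothOn_extend_tangent v)
      (hlam.mono (Set.subset_univ _)) (smoothOn_extend_spin (P.spinFrame x B))
    simp only [FiberBundle.extend_apply_self, hr, map_sum, map_smul, smul_eq_mul] at h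
    exact eq_neg_of_add_eq_zero_left h
  have hbianchi : ∀ A B, P.sigLow x (riemann nT x u v w) A B + P.sigLow x (riemann nT x v w u) A B
      + P.sigLow x (riemann nT x w u v) A B = 0 := by
    intro A B
    have h := bundleCurvature_cyclic hn.smooth_tangent hn.torsion_free hU hx
      (smoothOn_extend_tangent u) (smoothOn_extend_tangent v) (smoothOn_extend_tangent w)
    change riemann nT x u v w + riemann nT x v w u + riemann nT x w u v = 0 at h
    rw [← P.sigLow_add, ← P.sigLow_add, h]
    simp [SpinStructure.sigLow]
  simp only [hR] at hbianchi
  have hG : ∀ z, (einstein g nT x (P.toVector x (lam x)) z : ℂ)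
      = ∑ A, ∑ B, P.sigLow x z A B * einsteinForm a b c (bivecConj a) (bivecConj b) (bivecConj c)
        (P.sigLow x (P.toVector x (lam x))) (unitMatrix A B) := fun z => by
    rw [P.einstein_eq_einsteinForm x nT a b c _ _ _ hR, einsteinForm_eq]
  have hξ : P.sigLow x (P.toVector x (lam x))
      = fun A B => P.low x (lam x) A * conj (P.low x (lam x) B) := by
    funext A B
    exact P.sigLow_toVector x (lam x) A B
  simp only [hG]
  rw [P.sum_volumeForm_mul x u v w, hξ]
  have h := det_einsteinForm a b c (bivecConj a) (bivecConj b) (bivecConj c) (P.sigLow x u)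
    (P.sigLow x v) (P.sigLow x w) (P.low x (lam x)) (fun B => conj (P.low x (lam x) B)) rfl rfl
    (fun _ _ => rfl)
  simp only [hbianchi, mul_zero, Finset.sum_const_zero, add_zero] at h
  rw [← sub_eq_zero] at h ⊢
  refine Eq.trans ?_ ((congrArg (fun z => 4 * z) h).trans (mul_zero _))
  simp only [P.σ_eq, hRlam, Fin.sum_univ_two, spinMatrix, Matrix.cons_val_zero, Matrix.cons_val_one]
  ring

end CurvaturePart
/-! ### The exterior derivative of the Nester–Witten form -/

section ExteriorDerivative

variable {M : Type*} [TopologicalSpace M] [ChartedSpace E4 M]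
  [IsManifold (𝓡 4) ∞ M] {g : LorentzMetric M}
  {V : Type*} [NormedAddCommGroup V] [NormedSpace ℂ V]
  {S : M → Type*} [TopologicalSpace (TotalSpace V S)]
  [∀ x, AddCommGroup (S x)] [∀ x, Module ℂ (S x)] [∀ x, TopologicalSpace (S x)]
  [∀ x, IsTopologicalAddGroup (S x)] [∀ x, ContinuousSMul ℝ (S x)]
  [FiberBundle V S]
  {P : SpinStructure g V S}
  {nT : CovariantDerivative (𝓡 4) E4 (TangentSpace (𝓡 4) : M → Type _)}
  {nS : CovariantDerivative (𝓡 4) V S}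

/-- The second covariant derivative `u^a v^b ∇_a ∇_b λ` of a spinor field. -/
noncomputable def secondCovDeriv
    (nT : CovariantDerivative (𝓡 4) E4 (TangentSpace (𝓡 4) : M → Type _))
    (nS : CovariantDerivative (𝓡 4) V S) (lam : ∀ y, S y) (x : M)
    (u v : TangentSpace (𝓡 4) x) : S x :=
  nS (fun y => nS lam y (FiberBundle.extend E4 v y)) x u
    - nS lam x (nT (FiberBundle.extend E4 v) x u)

/-- For a torsion-free connection, the antisymmetric part of the second covariant derivative is the
curvature. -/
theorem secondCovDeriv_sub_swap (htor : nT.torsion = 0) (lam : ∀ y, S y) (x : M)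
    (u v : TangentSpace (𝓡 4) x) :
    secondCovDeriv nT nS lam x u v - secondCovDeriv nT nS lam x v u
      = bundleCurvature nS (FiberBundle.extend E4 u) (FiberBundle.extend E4 v) lam x := by
  have hU := isOpen_extendSet (V := V) (S := S) x
  have hx := mem_extendSet (V := V) (S := S) x
  have h := nT.torsion_eq_zero_iff.1 htor
    ((smoothOn_extend_tangent (V := V) (S := S) u).mdifferentiableAt hU hx)
    ((smoothOn_extend_tangent (V := V) (S := S) v).mdifferentiableAt hU hx)
  simp only [FiberBundle.extend_apply_self] at h
  simp only [secondCovDeriv, bundleCurvature, FiberBundle.extend_apply_self, ← h, map_sub]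
  abel

variable [T2Space M] [VectorBundle ℝ V S] [ContMDiffVectorBundle ∞ V S (𝓡 4)]

/-- As `σ` is parallel, differentiating `F` differentiates `∇λ` and `λ`; the derivatives of the
local extensions of `v` and `w` cancel. -/
theorem IsSpinCovariantDerivative.covDerivTwo_nesterWittenForm
    (hn : IsSpinCovariantDerivative P nT nS) {lam : ∀ y, S y} (hlam : SmoothOn V Set.univ lam)
    (x : M) (u v w : TangentSpace (𝓡 4) x) :
    covDerivTwo nT (P.nesterWittenForm nS lam) x u v w
      = Complex.I / 2 * (P.σ x v (secondCovDeriv nT nS lam x u w) (lam x)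
        + P.σ x v (nS lam x w) (nS lam x u)
        - P.σ x w (secondCovDeriv nT nS lam x u v) (lam x)
        - P.σ x w (nS lam x v) (nS lam x u)) := by
  have hU := isOpen_extendSet (V := V) (S := S) x
  have hx := mem_extendSet (V := V) (S := S) x
  have hl : SmoothOn V (extendSet V S x) lam := hlam.mono (Set.subset_univ _)
  have hd : ∀ v : TangentSpace (𝓡 4) x, SmoothOn V (extendSet V S x)
      (fun y => nS lam y (FiberBundle.extend E4 v y)) := fun v =>
    hl.covariantDerivative hn.smooth_spin hU (smoothOn_extend_tangent v)
  have hdiff : ∀ v w : TangentSpace (𝓡 4) x, MDifferentiableAt (𝓡 4) 𝓘(ℝ, ℂ) (fun y =>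
      P.σ y (FiberBundle.extend E4 v y) (nS lam y (FiberBundle.extend E4 w y)) (lam y)) x :=
    fun v w => ((P.contMDiffOn_σ hU (smoothOn_extend_tangent v) (hd w) hl).contMDiffAt
      (hU.mem_nhds hx)).mdifferentiableAt (by simp)
  have hσ : ∀ v w : TangentSpace (𝓡 4) x, mvfderiv (𝓡 4) (fun y =>
      P.σ y (FiberBundle.extend E4 v y) (nS lam y (FiberBundle.extend E4 w y)) (lam y)) x u
      = P.σ x (nT (FiberBundle.extend E4 v) x u) (nS lam x w) (lam x)
        + P.σ x v (nS (fun y => nS lam y (FiberBundle.extend E4 w y)) x u) (lam x)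
        + P.σ x v (nS lam x w) (nS lam x u) := fun v w => by
    have h := hn.σ_parallel x (FiberBundle.extend E4 v)
      (fun y => nS lam y (FiberBundle.extend E4 w y)) lam u
      ((smoothOn_extend_tangent (V := V) (S := S) v).mdifferentiableAt hU hx)
      ((hd w).mdifferentiableAt hU hx) (hl.mdifferentiableAt hU hx)
    simpa only [FiberBundle.extend_apply_self] using h
  have hF : (fun y => P.nesterWittenForm nS lam y (FiberBundle.extend E4 v y)
      (FiberBundle.extend E4 w y)) = fun y => ContinuousLinearMap.mul ℝ ℂ (Complex.I / 2)
      (P.σ y (FiberBundle.extend E4 v y) (nS lam y (FiberBundle.extend E4 w y)) (lam y)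
        - P.σ y (FiberBundle.extend E4 w y) (nS lam y (FiberBundle.extend E4 v y)) (lam y)) := by
    funext y
    rw [P.nesterWittenForm_eq, ContinuousLinearMap.mul_apply']
  have hsub : MDifferentiableAt (𝓡 4) 𝓘(ℝ, ℂ) (fun y =>
      P.σ y (FiberBundle.extend E4 v y) (nS lam y (FiberBundle.extend E4 w y)) (lam y)
        - P.σ y (FiberBundle.extend E4 w y) (nS lam y (FiberBundle.extend E4 v y)) (lam y)) x :=
    (hdiff v w).sub (hdiff w v)
  simp only [covDerivTwo]
  rw [hF, mvfderiv_clm_comp _ hsub, ContinuousLinearMap.mul_apply',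
    mvfderiv_fun_sub (hdiff v w) (hdiff w v), sub_apply, hσ, hσ]
  simp only [P.nesterWittenForm_eq, secondCovDeriv, map_sub, LinearMap.sub_apply]
  ring

/-- The exterior derivative of the Nester–Witten form: a part quadratic in `∇λ` and a curvature
part. -/
theorem IsSpinCovariantDerivative.antisymm_covDerivTwo_nesterWittenForm
    (hn : IsSpinCovariantDerivative P nT nS) {lam : ∀ y, S y} (hlam : SmoothOn V Set.univ lam)
    (x : M) (u v w : TangentSpace (𝓡 4) x) :
    3 * antisymm₃ (covDerivTwo nT (P.nesterWittenForm nS lam) x) u v w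
      = Complex.I / 2 *
          (P.σ x v (nS lam x w) (nS lam x u) - P.σ x w (nS lam x v) (nS lam x u)
            + (P.σ x w (nS lam x u) (nS lam x v) - P.σ x u (nS lam x w) (nS lam x v))
            + (P.σ x u (nS lam x v) (nS lam x w) - P.σ x v (nS lam x u) (nS lam x w)))
        - Complex.I / 2 *
          (P.σ x w (bundleCurvature nS (FiberBundle.extend E4 u) (FiberBundle.extend E4 v) lam x)
              (lam x)
            + P.σ x u (bundleCurvature nS (FiberBundle.extend E4 v) (FiberBundle.extend E4 w) lam x)
              (lam x)
            + P.σ x v (bundleCurvature nS (FiberBundle.extend E4 w) (FiberBundle.extend E4 u) lam x)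
              (lam x)) := by
  simp only [antisymm₃, hn.covDerivTwo_nesterWittenForm hlam,
    ← secondCovDeriv_sub_swap hn.torsion_free, map_sub, LinearMap.sub_apply]
  ring

/-- The identity `3 ∇_{[a} F_{bc]} = η_{abcf} (Z_d^{[df]} - (1/4) G_d^f ξ^d)`. -/
theorem IsSpinCovariantDerivative.sparling_identity
    (hn : IsSpinCovariantDerivative P nT nS) {lam : ∀ y, S y} (hlam : SmoothOn V Set.univ lam)
    (x : M) (u v w : TangentSpace (𝓡 4) x) :
    3 * antisymm₃ (covDerivTwo nT (P.nesterWittenForm nS lam) x) u v w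
      = ∑ f, (sgn f : ℂ) * P.volumeForm x u v w (g.frame x f) *
          (P.sparlingZTrace nS lam x (g.frame x f)
            - 1 / 4 * (einstein g nT x (P.toVector x (lam x)) (g.frame x f) : ℂ)) := by
  have hsplit : ∀ (c z e : Fin 4 → ℂ),
      ∑ f, c f * (z f - 1 / 4 * e f) = ∑ f, c f * z f - 1 / 4 * ∑ f, c f * e f := fun c z e => by
    rw [Finset.mul_sum, ← Finset.sum_sub_distrib]
    exact Finset.sum_congr rfl fun f _ => by ring
  rw [hsplit, P.sum_volumeForm_mul_sparlingZTrace, hn.sum_volumeForm_mul_einstein hlam,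
    hn.antisymm_covDerivTwo_nesterWittenForm hlam]
  ring

end ExteriorDerivative
/-! ### Smoothness of the Nester–Witten form -/

section Smoothness

variable {M : Type*} [TopologicalSpace M] [ChartedSpace E4 M]
  [IsManifold (𝓡 4) ∞ M] {g : LorentzMetric M}
  {V : Type*} [NormedAddCommGroup V] [NormedSpace ℂ V]
  {S : M → Type*} [TopologicalSpace (TotalSpace V S)]
  [∀ x, AddCommGroup (S x)] [∀ x, Module ℂ (S x)] [∀ x, TopologicalSpace (S x)]
  [∀ x, IsTopologicalAddGroup (S x)] [∀ x, ContinuousSMul ℝ (S x)]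
  [FiberBundle V S]

theorem SpinStructure.nesterWittenForm_swap (P : SpinStructure g V S)
    (nS : CovariantDerivative (𝓡 4) V S) (lam : ∀ y, S y) (x : M)
    (u v : TangentSpace (𝓡 4) x) :
    P.nesterWittenForm nS lam x v u = -P.nesterWittenForm nS lam x u v := by
  simp only [P.nesterWittenForm_eq]
  ring

variable [VectorBundle ℝ V S]

theorem SpinStructure.contMDiffAt_nesterWittenForm (P : SpinStructure g V S)
    {nS : CovariantDerivative (𝓡 4) V S}
    (hS : CovariantDerivative.ContMDiffCovariantDerivative nS ∞) {lam : ∀ y, S y}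
    (hlam : ContMDiff (𝓡 4) ((𝓡 4).prod 𝓘(ℝ, V)) ∞ (fun y => TotalSpace.mk' V y (lam y)))
    {x : M} {X Y : ∀ y : M, TangentSpace (𝓡 4) y} (hX : SmoothFieldAt X x)
    (hY : SmoothFieldAt Y x) :
    ContMDiffAt (𝓡 4) 𝓘(ℝ, ℂ) ∞ (fun y => P.nesterWittenForm nS lam y (X y) (Y y)) x := by
  have h1 := (contMDiffOn_univ.1 (hS.contMDiff.contMDiff (σ := lam) (by
    rw [contMDiffOn_univ]; exact hlam))) x
  have hd : ∀ {Z : ∀ y : M, TangentSpace (𝓡 4) y}, SmoothFieldAt Z x →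
      ContMDiffAt (𝓡 4) ((𝓡 4).prod 𝓘(ℝ, V)) ∞
        (fun y => TotalSpace.mk' V y (nS lam y (Z y))) x := fun hZ => h1.clm_bundle_apply hZ
  have hF : (fun y => P.nesterWittenForm nS lam y (X y) (Y y)) = fun y =>
      ContinuousLinearMap.mul ℝ ℂ (Complex.I / 2)
        (P.σ y (X y) (nS lam y (Y y)) (lam y) - P.σ y (Y y) (nS lam y (X y)) (lam y)) := by
    funext y
    rw [P.nesterWittenForm_eq, ContinuousLinearMap.mul_apply']
  rw [hF]
  exact (ContinuousLinearMap.contMDiff _).contMDiffAt.comp x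
    ((P.σ_smooth x X _ lam hX (hd hY) (hlam x)).sub (P.σ_smooth x Y _ lam hY (hd hX) (hlam x)))

end Smoothness

/-! ### The dominant property -/

section Dominance

variable {M : Type*} [TopologicalSpace M] [ChartedSpace E4 M]
  [IsManifold (𝓡 4) ∞ M] {g : LorentzMetric M}
  {V : Type*} [NormedAddCommGroup V] [NormedSpace ℂ V]
  {S : M → Type*} [TopologicalSpace (TotalSpace V S)]
  [∀ x, AddCommGroup (S x)] [∀ x, Module ℂ (S x)] [∀ x, TopologicalSpace (S x)]
  [FiberBundle V S]

namespace SpinStructure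

/-- There is a future-directed timelike vector with components `t^a σ_{aAA'}` the identity
matrix. -/
theorem exists_isFutureTimelike (P : SpinStructure g V S) (x : M) :
    ∃ t, P.IsFutureTimelike x t ∧ P.sigLow x t 0 0 = 1 ∧ P.sigLow x t 1 1 = 1
      ∧ P.sigLow x t 0 1 = 0 ∧ P.sigLow x t 1 0 = 0 := by
  set t : TangentSpace (𝓡 4) x := ∑ i, (sgn i * (P.sigLow x (g.frame x i) 0 0
    + P.sigLow x (g.frame x i) 1 1).re) • g.frame x i with ht
  have hre : ∀ i, (((P.sigLow x (g.frame x i) 0 0 + P.sigLow x (g.frame x i) 1 1).re : ℝ) : ℂ)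
      = P.sigLow x (g.frame x i) 0 0 + P.sigLow x (g.frame x i) 1 1 := fun i =>
    Complex.conj_eq_iff_re.1 (by rw [map_add, P.sigLow_conj, P.sigLow_conj])
  have hcomp : ∀ A B, P.sigLow x t A B = epsUp A 0 * epsUp B 0 + epsUp A 1 * epsUp B 1 := by
    intro A B
    rw [ht, P.sigLow_sum, ← P.sigLow_complete, ← P.sigLow_complete, ← Finset.sum_add_distrib]
    refine Finset.sum_congr rfl fun i _ => ?_
    rw [Complex.ofReal_mul, hre]
    ring
  have h00 : P.sigLow x t 0 0 = 1 := by rw [hcomp]; simp [epsUp]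
  have h11 : P.sigLow x t 1 1 = 1 := by rw [hcomp]; simp [epsUp]
  have h01 : P.sigLow x t 0 1 = 0 := by rw [hcomp]; simp [epsUp]
  have h10 : P.sigLow x t 1 0 = 0 := by rw [hcomp]; simp [epsUp]
  refine ⟨t, ⟨?_, fun κ hκ => ?_⟩, h00, h11, h01, h10⟩
  · have h := P.val_eq x t t
    rw [h00, h11, h01, h10] at h
    have h2 : g.val x t t = 2 := by
      apply Complex.ofReal_injective
      rw [h]
      push_cast
      ring
    rw [h2]
    norm_num
  · rw [P.σ_eq, h00, h11, h01, h10]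
    simp only [one_mul, zero_mul, sub_zero, Complex.mul_conj, ← Complex.ofReal_add,
      Complex.ofReal_re]
    by_contra hle
    have n0 := Complex.normSq_nonneg (P.low x κ 0)
    have n1 := Complex.normSq_nonneg (P.low x κ 1)
    have z0 : P.low x κ 0 = 0 := Complex.normSq_eq_zero.1 (by linarith)
    have z1 : P.low x κ 1 = 0 := Complex.normSq_eq_zero.1 (by linarith)
    apply hκ
    rw [P.spinor_eq x κ, z0, z1]
    simp

/-- The components of a future-directed null vector are a nonnegative multiple of
`κ_A \bar κ_{A'}`. -/
theorem IsFutureNull.exists_spinor {P : SpinStructure g V S} {x : M} {k : TangentSpace (𝓡 4) x}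
    (hk : P.IsFutureNull x k) : ∃ (c : ℝ) (κ : Fin 2 → ℂ), 0 ≤ c ∧
      ∀ A B, P.sigLow x k A B = c * (κ A * conj (κ B)) := by
  obtain ⟨t, ht, t00, t11, t01, t10⟩ := P.exists_isFutureTimelike x
  have hpos := hk.2.2 t ht
  have hval := P.val_eq x k t
  have hnull := P.val_eq x k k
  rw [hk.2.1] at hnull
  rw [t00, t11, t01, t10] at hval
  have r00 := Complex.conj_eq_iff_re.1 (P.sigLow_conj x k 0 0)
  have r11 := Complex.conj_eq_iff_re.1 (P.sigLow_conj x k 1 1)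
  have c01 := P.sigLow_conj x k 0 1
  have c10 := P.sigLow_conj x k 1 0
  set p := (P.sigLow x k 0 0).re with hp
  set q := (P.sigLow x k 1 1).re with hq
  set z := P.sigLow x k 1 0 with hz
  rw [← c10, ← r00, ← r11] at hnull
  rw [← r00, ← r11] at hval
  have hsum : 0 < p + q := by
    have : g.val x k t = p + q := by
      apply Complex.ofReal_injective
      rw [hval]
      push_cast
      ring
    rwa [this] at hpos
  have hdet : p * q = Complex.normSq z := by
    apply Complex.ofReal_injective
    rw [Complex.normSq_eq_conj_mul_self]
    push_cast at hnull ⊢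
    linear_combination -(1 / 2) * hnull
  have hn := Complex.normSq_nonneg z
  -- a hermitian matrix with vanishing determinant is a multiple of `κ κ^*` with `κ` its first
  -- column, if that does not vanish, and otherwise its only nonzero entry is the last one
  rcases eq_or_ne p 0 with h0 | h0
  · have hz0 : z = 0 := Complex.normSq_eq_zero.1 (by rw [← hdet, h0, zero_mul])
    refine ⟨q, ![0, 1], by linarith, fun A B => ?_⟩
    rw [h0] at r00
    rw [hz0] at c10
    fin_cases A <;> fin_cases B
    · simp [← r00]
    · simp [← c10]
    · simp [← hz, hz0]
    · simp [r11]
  · have hp0 : 0 < p := by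
      by_contra hle
      have : p < 0 := lt_of_le_of_ne (not_lt.1 hle) h0
      nlinarith
    have hpc : (p : ℂ) ≠ 0 := by exact_mod_cast h0
    refine ⟨p⁻¹, ![(p : ℂ), z], by positivity, fun A B => ?_⟩
    fin_cases A <;> fin_cases B
    · simp [← r00, hpc]
    · simp [← c10, hpc]
    · simp [← hz, hpc, mul_comm z]
    · have : (q : ℂ) = (p : ℂ)⁻¹ * (z * conj z) := by
        rw [Complex.mul_conj, ← hdet]
        push_cast
        field_simp
      simpa [r11] using r11.symm.trans this

variable [∀ x, IsTopologicalAddGroup (S x)] [∀ x, ContinuousSMul ℝ (S x)]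

/-- On null vectors `κ_i^A \bar κ_i^{A'}` the tensor `Z` is the squared modulus of
`κ_1^A κ_2^B \bar κ_3^{C'} ∇_{BC'} λ_A`. -/
theorem sparlingZ_nonneg (P : SpinStructure g V S) (nS : CovariantDerivative (𝓡 4) V S)
    (lam : ∀ y, S y) {x : M} {k₁ k₂ k₃ : TangentSpace (𝓡 4) x} (h₁ : P.IsFutureNull x k₁)
    (h₂ : P.IsFutureNull x k₂) (h₃ : P.IsFutureNull x k₃) :
    (P.sparlingZ nS lam x k₁ k₂ k₃).im = 0 ∧ 0 ≤ (P.sparlingZ nS lam x k₁ k₂ k₃).re := by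
  obtain ⟨a, κ, ha, hκ⟩ := h₁.exists_spinor
  obtain ⟨b, μ, hb, hμ⟩ := h₂.exists_spinor
  obtain ⟨c, ν, hc, hν⟩ := h₃.exists_spinor
  set z : ℂ := ∑ A, ∑ B, ∑ C, ![κ 1, -κ 0] A * ![μ 1, -μ 0] B * conj (![ν 1, -ν 0] C)
    * P.nabla nS lam x B C A with hz
  have h : P.sparlingZ nS lam x k₁ k₂ k₃ = ((a * b * c * Complex.normSq z : ℝ) : ℂ) := by
    push_cast
    rw [← Complex.mul_conj, hz]
    simp only [sparlingZ, P.sigUp_eq, hκ, hμ, hν, map_mul, P.conj_nabla,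
      Complex.conj_conj, Fin.sum_univ_two, Matrix.cons_val_zero, Matrix.cons_val_one, map_neg,
      map_add]
    ring
  rw [h, Complex.ofReal_im, Complex.ofReal_re]
  exact ⟨rfl, mul_nonneg (mul_nonneg (mul_nonneg ha hb) hc) (Complex.normSq_nonneg z)⟩

end SpinStructure
end Dominance
end Sparling

theorem mainTheorem1
    {M : Type*} [TopologicalSpace M] [T2Space M] [ChartedSpace Sparling.E4 M]
    [IsManifold (𝓡 4) ∞ M]
    (g : Sparling.LorentzMetric M)
    {V : Type*} [NormedAddCommGroup V] [NormedSpace ℂ V] [FiniteDimensional ℂ V]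
    {S : M → Type*} [TopologicalSpace (TotalSpace V S)]
    [∀ x, AddCommGroup (S x)] [∀ x, Module ℂ (S x)] [∀ x, TopologicalSpace (S x)]
    [∀ x, IsTopologicalAddGroup (S x)] [∀ x, ContinuousSMul ℝ (S x)]
    [FiberBundle V S] [VectorBundle ℂ V S] [VectorBundle ℝ V S]
    [ContMDiffVectorBundle ∞ V S (𝓡 4)]
    (P : Sparling.SpinStructure g V S)
    (nT : CovariantDerivative (𝓡 4) Sparling.E4 (TangentSpace (𝓡 4) : M → Type _))
    (nS : CovariantDerivative (𝓡 4) V S)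
    (hn : Sparling.IsSpinCovariantDerivative P nT nS)
    (lam : ∀ y, S y)
    (hlam : ContMDiff (𝓡 4) ((𝓡 4).prod 𝓘(ℝ, V)) ∞ (fun y => TotalSpace.mk' V y (lam y))) :
    -- `F_{ab}` is a smooth 2-form
    (∀ (x : M) (u v : TangentSpace (𝓡 4) x),
        P.nesterWittenForm nS lam x v u = -P.nesterWittenForm nS lam x u v) ∧
    (∀ (x : M) (X Y : ∀ y : M, TangentSpace (𝓡 4) y),
        Sparling.SmoothFieldAt X x → Sparling.SmoothFieldAt Y x →
        ContMDiffAt (𝓡 4) 𝓘(ℝ, ℂ) ∞ (fun y => P.nesterWittenForm nS lam y (X y) (Y y)) x) ∧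
    -- `3 ∇_{[a} F_{bc]} = η_{abcf} (Z_d^{[df]} - (1/4) G_d^f ξ^d)`
    (∀ (x : M) (u v w : TangentSpace (𝓡 4) x),
        3 * Sparling.antisymm₃
            (Sparling.covDerivTwo nT (P.nesterWittenForm nS lam) x) u v w
          = ∑ f, (Sparling.sgn f : ℂ) * P.volumeForm x u v w (g.frame x f) *
              (P.sparlingZTrace nS lam x (g.frame x f)
                - 1 / 4 * (Sparling.einstein g nT x (P.toVector x (lam x)) (g.frame x f) : ℂ))) ∧
    -- the dominant property
    (∀ (x : M) (k₁ k₂ k₃ : TangentSpace (𝓡 4) x),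
        P.IsFutureNull x k₁ → P.IsFutureNull x k₂ → P.IsFutureNull x k₃ →
        (P.sparlingZ nS lam x k₁ k₂ k₃).im = 0 ∧
          0 ≤ (P.sparlingZ nS lam x k₁ k₂ k₃).re) :=
  ⟨fun x u v => P.nesterWittenForm_swap nS lam x u v,
    fun _ _ _ hX hY => P.contMDiffAt_nesterWittenForm hn.smooth_spin hlam hX hY,
    fun x u v w => hn.sparling_identity hlam.contMDiffOn x u v w,
    fun _ _ _ _ h₁ h₂ h₃ => P.sparlingZ_nonneg nS lam h₁ h₂ h₃⟩
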